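/- Let $n\ge 1$. A cube is a non-degenerate closed cube in $\mathbb R^n$ with sides parallel to the coordinate axes. Let $w$ be a non-negative, locally integrable function on $\mathbb R^n$ which is not almost everywhere zero, and write $w(S)=\int_S w(x)\,dx$. Suppose that $w$ is a Muckenhoupt $A_\infty$ weight, that is, $$[w]_{A_\infty}:=\sup_Q \frac1{w(Q)}\int_Q M(w\chi_Q)(x)\,dx<\infty ,\qquad Mf(x):=\sup_{Q\ni x}\frac1{|Q|}\int_Q|f(y)|\,dy,$$ where the suprema are over all cubes $Q$, respectively all cubes $Q$ containing $x$, and $0/0:=0$. Let $$M_wf(x):=\sup_{Q\ni x}\frac1{w(Q)}\int_Q|f(y)|\,w(y)\,dy$$ be the uncentered maximal operator over cubes with respect to the measure $w\,dx$, and for $0<\alpha<1$ let $$C_w(\alpha):=\sup\Big\{\frac{w(\{x\in\mathbb R^n: M_w\chi_E(x)>\alpha\})}{w(E)} : E\subseteq\mathbb R^n \text{ measurable},\ 0<w(E)<\infty\Big\}$$ be its sharp Tauberian constant. Then there are constants $C_{w,n},c_{w,n}>0$, depending only on $w$ and $n$, such that for all $\alpha<1$ sufficiently close to $1$ the number $C_w(\alpha)$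 is finite and $$C_w(\alpha)-1\le C_{w,n}(1-\alpha)^{c_{w,n}} .$$ In particular $\lim_{\alpha\to1^-}C_w(\alpha)=1$. -/

import Mathlib

open MeasureTheory Filter Topology
open scoped ENNReal

noncomputable section

/-- The closed cube in `ℝⁿ` with sides parallel to the axes, centre `c` and sidelength `r`. -/
def cube {n : ℕ} (c : Fin n → ℝ) (r : ℝ) : Set (Fin n → ℝ) :=
  {x | ∀ i, |x i - c i| ≤ r / 2}

/-- The uncentered maximal function of `f` over cubes, with respect to the measure `μ`:
`M_μ f (x) = sup (1 / μ(Q)) ∫_Q |f| dμ`, the supremum being over all cubes `Q` containing `x`.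
(A cube of measure zero contributes `0 / 0 = 0`.) -/
def maximalFunction {n : ℕ} (μ : Measure (Fin n → ℝ)) (f : (Fin n → ℝ) → ℝ)
    (x : Fin n → ℝ) : ℝ≥0∞ :=
  ⨆ (c : Fin n → ℝ) (r : ℝ) (_ : 0 < r) (_ : x ∈ cube c r),
    (∫⁻ y in cube c r, ‖f y‖ₑ ∂μ) / μ (cube c r)

/-- The measure `w(x) dx` on `ℝⁿ`. -/
def weightMeasure {n : ℕ} (w : (Fin n → ℝ) → ℝ) : Measure (Fin n → ℝ) :=
  (volume : Measure (Fin n → ℝ)).withDensity (fun x => ENNReal.ofReal (w x))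

/-- A weight on `ℝⁿ`: a non-negative, locally integrable function. -/
structure IsWeight {n : ℕ} (w : (Fin n → ℝ) → ℝ) : Prop where
  nonneg : ∀ x, 0 ≤ w x
  locallyIntegrable : LocallyIntegrable w (volume : Measure (Fin n → ℝ))

/-- The Fujii–Wilson constant `[w]_{A_∞} = sup_Q (1 / w(Q)) ∫_Q M(w χ_Q) dx`, the supremum being
over all cubes `Q`, with `M` the uncentered maximal operator with respect to Lebesgue measure. -/
def fujiiWilsonConst {n : ℕ} (w : (Fin n → ℝ) → ℝ) : ℝ≥0∞ :=
  ⨆ (c : Fin n → ℝ) (r : ℝ) (_ : 0 < r),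
    (∫⁻ x in cube c r, maximalFunction volume ((cube c r).indicator w) x) /
      weightMeasure w (cube c r)

/-- The Muckenhoupt class `A_∞`. -/
structure IsAInfty {n : ℕ} (w : (Fin n → ℝ) → ℝ) : Prop where
  isWeight : IsWeight w
  const_lt_top : fujiiWilsonConst w < ∞

/-- The sharp Tauberian constant of the maximal operator `M_w` with respect to `w(x) dx`:
`C_w(α) = sup w(E)⁻¹ w({x : M_w χ_E (x) > α})`, the supremum being over all (Lebesgue) measurable
sets `E` with `0 < w(E) < ∞`. -/
def sharpTauberianConst {n : ℕ} (w : (Fin n → ℝ) → ℝ) (α : ℝ) : ℝ≥0∞ :=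
  ⨆ (E : Set (Fin n → ℝ)) (_ : NullMeasurableSet E (volume : Measure (Fin n → ℝ)))
    (_ : 0 < weightMeasure w E) (_ : weightMeasure w E < ∞),
    weightMeasure w {x | ENNReal.ofReal α <
        maximalFunction (weightMeasure w) (E.indicator fun _ => (1 : ℝ)) x} /
      weightMeasure w E

end

/-! The set where `M_w χ_E > α` is covered by cubes that `E` fills up to a proportion `ε = 1 - α` of
their `w`-mass, so the task is to bound the mass of a union of such cubes by `(1 + A ε^a) w(E)`.
Besides local finiteness, the only property of `w` used for this bound is a power modulus, `w(A) ≤ C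
(|A|/|Q|)^c w(Q)` for `A ⊆ Q`. It comes from the Fujii–Wilson constant by a stopping-time argument:
the integrals of the dyadic maximal function over its high level sets decay geometrically
(`two_pow_mul_setLIntegral_levelSet_le`, `IsAInfty.exists_hasPowerModulus`).

For finitely many cubes, a selection from largest to smallest
(`exists_subset_measure_sdiff_le_and_subset_dilate`) keeps a cube when at least a fraction `κ = √ε`
of its mass is new. The errors `κ² w(Q)` are charged to the new parts, so the kept cubes have union
of mass at most `(1 + 2κ) w(E)`. By doubling, every rejected cube lies in the `(1 + 2η)`-dilates of
the kept ones, with `η` a power of `ε` up to a constant.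

It remains that slight dilation raises the mass of a finite union only slightly
(`HasPowerModulus.exists_measure_dilate_le`). For Lebesgue measure this reduces, one coordinate at a
time, to intervals (`volume_iUnion_closedBall_dilate_le`). A Vitali selection localizes the added
halo inside single cubes, where the modulus and doubling transfer the estimate to `w`. A Lindelöf
argument passes from finitely many cubes to all of them. -/

/-! ### Lebesgue measure of unions of dilated cubes -/

/-- Enlarging finitely many intervals to the right by a factor `1 + η` of their lengths multiplies
the measure of their union by at most `1 + η`. -/
theorem volume_iUnion_Icc_extend_right_le {ι : Type*} (s : Finset ι) (a b : ι → ℝ)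
    (hab : ∀ i, a i ≤ b i) {η : ℝ} (hη : 0 ≤ η) :
    volume (⋃ i ∈ s, Set.Icc (a i) (b i + η * (b i - a i))) ≤
      ENNReal.ofReal (1 + η) * volume (⋃ i ∈ s, Set.Icc (a i) (b i)) := by
  classical
  induction s using Finset.induction_on_max_value a with
  | empty => simp
  | insert j s hj hmax ih =>
    rw [Finset.set_biUnion_insert, Finset.set_biUnion_insert, Set.union_comm,
      Set.union_comm (Set.Icc (a j) (b j))]
    set A := ⋃ i ∈ s, Set.Icc (a i) (b i) with hA
    set A' := ⋃ i ∈ s, Set.Icc (a i) (b i + η * (b i - a i)) with hA'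
    have hAm : MeasurableSet A := s.measurableSet_biUnion fun _ _ => measurableSet_Icc
    -- Interval `j` has the largest left endpoint; let `i` be the earlier one reaching furthest
    -- right. If `b i < a j`, then `A` misses `(a j, b j]`. Otherwise enlarged interval `i` already
    -- covers `a j` up to its own right end, and what remains has length at most `(1 + η) (b j - b
    -- i)` because `a i ≤ a j`.
    have key : volume (Set.Icc (a j) (b j + η * (b j - a j)) \ A') ≤
        ENNReal.ofReal (1 + η) * volume (Set.Icc (a j) (b j) \ A) := by
      have hlen : ∀ β : ℝ, ENNReal.ofReal (1 + η) * volume (Set.Ioc β (b j)) =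
          ENNReal.ofReal ((1 + η) * (b j - β)) := fun β => by
        rw [Real.volume_Ioc, ENNReal.ofReal_mul (by linarith)]
      have hbj := hab j
      rcases s.eq_empty_or_nonempty with rfl | hs
      · simp only [hA, hA', Finset.notMem_empty, Set.iUnion_of_empty, Set.iUnion_empty,
          Set.sdiff_empty, Real.volume_Icc]
        rw [← ENNReal.ofReal_mul (by linarith)]
        exact ENNReal.ofReal_le_ofReal (by linarith)
      obtain ⟨i, hi, hib⟩ := s.exists_max_image b hs
      have hai := hmax i hi
      have hAb : ∀ x ∈ A, x ≤ b i := fun x hx => by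
        obtain ⟨k, hk, hx⟩ := Set.mem_iUnion₂.1 hx
        exact hx.2.trans (hib k hk)
      rcases lt_or_ge (b i) (a j) with h | h
      · calc _ ≤ volume (Set.Icc (a j) (b j + η * (b j - a j))) :=
              measure_mono Set.sdiff_subset
          _ = ENNReal.ofReal (1 + η) * volume (Set.Ioc (a j) (b j)) := by
              rw [hlen, Real.volume_Icc]; congr 1; ring
          _ ≤ _ := by
              gcongr
              exact fun x hx => ⟨⟨hx.1.le, hx.2⟩, fun hxA => by linarith [hAb x hxA, hx.1]⟩
      · calc _ ≤ volume (Set.Ioc (b i + η * (b i - a i)) (b j + η * (b j - a j))) := by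
              refine measure_mono fun x hx => ⟨?_, hx.1.2⟩
              by_contra! hle
              exact hx.2 (Set.mem_iUnion₂.2 ⟨i, hi, hai.trans hx.1.1, hle⟩)
          _ ≤ ENNReal.ofReal (1 + η) * volume (Set.Ioc (b i) (b j)) := by
              rw [hlen, Real.volume_Ioc]
              refine ENNReal.ofReal_le_ofReal ?_
              nlinarith
          _ ≤ _ := by
              gcongr
              exact fun x hx => ⟨⟨h.trans hx.1.le, hx.2⟩, fun hxA => by linarith [hAb x hxA, hx.1]⟩
    calc volume (A' ∪ Set.Icc (a j) (b j + η * (b j - a j)))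
        ≤ volume A' + volume (Set.Icc (a j) (b j + η * (b j - a j)) \ A') := by
          rw [← Set.union_sdiff_self]; exact measure_union_le _ _
      _ ≤ ENNReal.ofReal (1 + η) * volume A +
          ENNReal.ofReal (1 + η) * volume (Set.Icc (a j) (b j) \ A) := add_le_add ih key
      _ = _ := by
          rw [← mul_add, ← measure_union Set.disjoint_sdiff_right
            (measurableSet_Icc.diff hAm), Set.union_sdiff_self]

/-- Dilating finitely many intervals about their centres by `1 + η` multiplies the measure of their
union by at most `(1 + η) ^ 2`. -/
theorem volume_iUnion_Icc_dilate_le {ι : Type*} (s : Finset ι) (c r : ι → ℝ)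
    (hr : ∀ i, 0 ≤ r i) {η : ℝ} (hη : 0 ≤ η) :
    volume (⋃ i ∈ s, Set.Icc (c i - (1 + η) * r i) (c i + (1 + η) * r i)) ≤
      ENNReal.ofReal ((1 + η) ^ 2) * volume (⋃ i ∈ s, Set.Icc (c i - r i) (c i + r i)) := by
  have hneg : ∀ a b : ι → ℝ, volume (⋃ i ∈ s, Set.Icc (a i) (b i)) =
      volume (⋃ i ∈ s, Set.Icc (-b i) (-a i)) := fun a b => by
    rw [← Measure.measure_neg (volume : Measure ℝ) (⋃ i ∈ s, Set.Icc (a i) (b i))]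
    congr 1
    simp only [← Set.neg_Icc, Set.iUnion_neg]
  have hp : ∀ i, 0 ≤ η * r i := fun i => mul_nonneg hη (hr i)
  -- Each end costs one factor `1 + η`: extend to the right, reflect, and extend to the right again.
  -- Both extensions overshoot, since they are measured by full lengths and not radii.
  have h1 := volume_iUnion_Icc_extend_right_le s (fun i => c i - r i)
    (fun i => c i + r i) (fun i => by linarith [hr i]) hη
  have h2 := volume_iUnion_Icc_extend_right_le s (fun i => -(c i + (1 + η) * r i))
    (fun i => -(c i - r i)) (fun i => by linarith [hr i, hp i]) hη
  rw [pow_two, ENNReal.ofReal_mul (by linarith), mul_assoc]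
  refine le_trans ?_ (mul_le_mul_right h1 _)
  calc _ ≤ _ := ?_
    _ ≤ _ := h2
    _ ≤ _ := ?_
  · rw [hneg]
    refine measure_mono (Set.iUnion₂_mono fun i _ => Set.Icc_subset_Icc_right ?_)
    nlinarith [hr i, hp i, mul_nonneg hη (hp i)]
  · rw [← hneg]
    refine mul_le_mul_right (measure_mono (Set.iUnion₂_mono fun i _ =>
      Set.Icc_subset_Icc_right ?_)) _
    nlinarith [hr i, hp i]

/-- Dilating finitely many boxes about their centres by `1 + η` in one coordinate direction
multiplies the measure of their union by at most `(1 + η) ^ 2`. -/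
theorem volume_iUnion_box_dilate_coord_le {n : ℕ} {ι : Type*} (s : Finset ι)
    (c ρ : ι → Fin n → ℝ) (hρ : ∀ i k, 0 ≤ ρ i k) (k : Fin n) {η : ℝ} (hη : 0 ≤ η) :
    volume (⋃ i ∈ s, {x : Fin n → ℝ | ∀ l, |x l - c i l| ≤
        Function.update (ρ i) k ((1 + η) * ρ i k) l}) ≤
      ENNReal.ofReal ((1 + η) ^ 2) *
        volume (⋃ i ∈ s, {x : Fin n → ℝ | ∀ l, |x l - c i l| ≤ ρ i l}) := by
  classical
  have hm : ∀ ρ : ι → Fin n → ℝ, MeasurableSet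
      (⋃ i ∈ s, {x : Fin n → ℝ | ∀ l, |x l - c i l| ≤ ρ i l}) := fun ρ =>
    s.measurableSet_biUnion fun i _ => by
      rw [Set.ofPred_forall]
      exact MeasurableSet.iInter fun l => measurableSet_le (by fun_prop) measurable_const
  set A := ⋃ i ∈ s, {x : Fin n → ℝ | ∀ l, |x l - c i l| ≤ ρ i l}
  set A' := ⋃ i ∈ s, {x : Fin n → ℝ | ∀ l, |x l - c i l| ≤
        Function.update (ρ i) k ((1 + η) * ρ i k) l}
  have hA : MeasurableSet A := hm ρ
  have hA' : MeasurableSet A' := hm fun i => Function.update (ρ i) k ((1 + η) * ρ i k)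
  rw [← lintegral_indicator_one hA', ← lintegral_indicator_one hA,
    ← lintegral_const_mul _ (measurable_one.indicator hA)]
  -- Fubini: it is enough to compare sections along lines in direction `k`, which are unions of
  -- intervals.
  refine lintegral_le_of_lmarginal_le {k} (measurable_one.indicator hA')
    ((measurable_one.indicator hA).const_mul _) ?_
  intro x
  rw [lmarginal_singleton, lmarginal_singleton]
  have hup : Measurable fun t : ℝ => Function.update x k t := measurable_update x
  beta_reduce
  rw [lintegral_const_mul (f := fun t => A.indicator 1 (Function.update x k t)) _
    ((measurable_one.indicator hA).comp hup)]
  have h : ∀ B : Set (Fin n → ℝ), MeasurableSet B →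
      ∫⁻ t : ℝ, B.indicator 1 (Function.update x k t) = volume {t | Function.update x k t ∈ B} :=
    fun B hB => by
      have := lintegral_indicator_one (μ := (volume : Measure ℝ)) (hup hB)
      exact this
  rw [h A hA, h A' hA']
  let s' := s.filter fun i => ∀ l, l ≠ k → |x l - c i l| ≤ ρ i l
  have hsec : ∀ ρ' : ι → ℝ, {t | Function.update x k t ∈ ⋃ i ∈ s, {x : Fin n → ℝ |
      ∀ l, |x l - c i l| ≤ Function.update (ρ i) k (ρ' i) l}} =
      ⋃ i ∈ s', Set.Icc (c i k - ρ' i) (c i k + ρ' i) := fun ρ' => by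
    ext t
    simp only [Set.mem_ofPred_eq, Set.mem_iUnion, s', Finset.mem_filter, exists_prop, and_assoc,
      Set.mem_Icc]
    refine exists_congr fun i => and_congr_right fun _ => ⟨fun H => ⟨fun l hl => ?_, ?_⟩, fun H l => ?_⟩
    · simpa [hl] using H l
    · have := H k
      simp only [Function.update_self, abs_le] at this
      exact ⟨by linarith, by linarith⟩
    · rcases eq_or_ne l k with rfl | hl
      · simp only [Function.update_self, abs_le]
        exact ⟨by linarith [H.2.1], by linarith [H.2.2]⟩
      · simpa [hl] using H.1 l hl
  have h0 : {t | Function.update x k t ∈ A} =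
      ⋃ i ∈ s', Set.Icc (c i k - ρ i k) (c i k + ρ i k) := by
    rw [← hsec]; simp only [Function.update_eq_self, A]
  rw [h0, hsec]
  exact volume_iUnion_Icc_dilate_le s' (fun i => c i k) (fun i => ρ i k) (fun i => hρ i k) hη

/-- Dilating finitely many cubes about their centres by `1 + η` multiplies the measure of their
union by at most `(1 + η) ^ (2 * n)`. -/
theorem volume_iUnion_closedBall_dilate_le {n : ℕ} {ι : Type*} (s : Finset ι)
    (c : ι → Fin n → ℝ) (r : ι → ℝ) (hr : ∀ i, 0 ≤ r i) {η : ℝ} (hη : 0 ≤ η) :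
    volume (⋃ i ∈ s, Metric.closedBall (c i) ((1 + η) * r i)) ≤
      ENNReal.ofReal ((1 + η) ^ (2 * n)) * volume (⋃ i ∈ s, Metric.closedBall (c i) (r i)) := by
  classical
  have key : ∀ T : Finset (Fin n), volume (⋃ i ∈ s, {x : Fin n → ℝ | ∀ l, |x l - c i l| ≤
        if l ∈ T then (1 + η) * r i else r i}) ≤
      ENNReal.ofReal ((1 + η) ^ (2 * T.card)) *
        volume (⋃ i ∈ s, {x : Fin n → ℝ | ∀ l, |x l - c i l| ≤ r i}) := by
    intro T
    induction T using Finset.induction_on with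
    | empty => simp
    | insert k T hk ih =>
      have h := volume_iUnion_box_dilate_coord_le s c
        (fun i l => if l ∈ T then (1 + η) * r i else r i)
        (fun i l => by
          have := mul_nonneg hη (hr i)
          have := hr i
          split_ifs <;> nlinarith) k hη
      have hup : ∀ i, Function.update (fun l => if l ∈ T then (1 + η) * r i else r i) k
          ((1 + η) * if k ∈ T then (1 + η) * r i else r i) =
          fun l => if l ∈ insert k T then (1 + η) * r i else r i := fun i => by
        ext l
        rcases eq_or_ne l k with rfl | hl
        · simp [hk]
        · simp [hl]
      simp only [hup] at h
      refine h.trans ((mul_le_mul_right ih _).trans_eq ?_)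
      rw [← mul_assoc, ← ENNReal.ofReal_mul (by positivity), Finset.card_insert_of_notMem hk]
      congr 2
      ring
  have hball : ∀ i (t : ℝ), 0 ≤ t →
      Metric.closedBall (c i) t = {x : Fin n → ℝ | ∀ l, |x l - c i l| ≤ t} := fun i t ht => by
    ext x
    simp [dist_pi_le_iff ht, Real.dist_eq]
  have h := key Finset.univ
  simp only [Finset.mem_univ, if_true, Finset.card_univ, Fintype.card_fin] at h
  simpa only [hball _ _ (hr _), hball _ _ (mul_nonneg (add_nonneg zero_le_one hη) (hr _))] using h

/-! ### Dyadic cells and the dyadic maximal function -/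

theorem cube_eq_closedBall {n : ℕ} (c : Fin n → ℝ) {r : ℝ} (hr : 0 ≤ r) :
    cube c r = Metric.closedBall c (r / 2) := by
  ext x
  simp [cube, dist_pi_le_iff (by linarith : 0 ≤ r / 2), Real.dist_eq]

theorem measurableSet_cube {n : ℕ} (c : Fin n → ℝ) {r : ℝ} (hr : 0 ≤ r) :
    MeasurableSet (cube c r) := by
  rw [cube_eq_closedBall c hr]; exact Metric.isClosed_closedBall.measurableSet

theorem weightMeasure_apply_lt_top_of_isCompact {n : ℕ} {w : (Fin n → ℝ) → ℝ} (hw : IsWeight w)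
    {S : Set (Fin n → ℝ)} (hS : IsCompact S) : weightMeasure w S < ∞ := by
  rw [weightMeasure, withDensity_apply' _ S]
  exact (hw.locallyIntegrable.integrableOn_isCompact hS).lintegral_lt_top

/-- The index of the cell of generation `k` containing `x`, in the dyadic grid generated by the
half-open cube with lower corner `a` and sidelength `ρ`. -/
noncomputable def dyadicIndex {n : ℕ} (a : Fin n → ℝ) (ρ : ℝ) (k : ℕ) (x : Fin n → ℝ) :
    Fin n → ℤ :=
  fun i => ⌊2 ^ k * ((x i - a i) / ρ)⌋

/-- The half-open dyadic cell of generation `k` and index `m`. -/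
def dyadicCell {n : ℕ} (a : Fin n → ℝ) (ρ : ℝ) (k : ℕ) (m : Fin n → ℤ) : Set (Fin n → ℝ) :=
  {x | dyadicIndex a ρ k x = m}

/-- The centre of the dyadic cell of generation `k` and index `m`. -/
noncomputable def dyadicCenter {n : ℕ} (a : Fin n → ℝ) (ρ : ℝ) (k : ℕ) (m : Fin n → ℤ) :
    Fin n → ℝ :=
  fun i => a i + (m i + 1 / 2) * (ρ / 2 ^ k)

/-- The Lebesgue average of `μ` over a dyadic cell. -/
noncomputable def dyadicAverage {n : ℕ} (μ : Measure (Fin n → ℝ)) (a : Fin n → ℝ) (ρ : ℝ) (k : ℕ)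
    (m : Fin n → ℤ) : ℝ≥0∞ :=
  μ (dyadicCell a ρ k m) / volume (dyadicCell a ρ k m)

/-- The dyadic maximal function of the measure `μ`. -/
noncomputable def dyadicMaximal {n : ℕ} (μ : Measure (Fin n → ℝ)) (a : Fin n → ℝ) (ρ : ℝ)
    (x : Fin n → ℝ) : ℝ≥0∞ :=
  ⨆ k, dyadicAverage μ a ρ k (dyadicIndex a ρ k x)

section Dyadic

variable {n : ℕ} {a : Fin n → ℝ} {ρ : ℝ}

theorem measurable_dyadicIndex (k : ℕ) : Measurable (dyadicIndex a ρ k) :=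
  measurable_pi_iff.2 fun i => Int.measurable_floor.comp (by fun_prop)

theorem measurableSet_dyadicCell (k : ℕ) (m : Fin n → ℤ) : MeasurableSet (dyadicCell a ρ k m) :=
  measurable_dyadicIndex k (measurableSet_singleton m)

theorem measurable_dyadicMaximal (μ : Measure (Fin n → ℝ)) : Measurable (dyadicMaximal μ a ρ) :=
  Measurable.iSup fun k => (Measurable.of_discrete (f := dyadicAverage μ a ρ k)).comp
    (measurable_dyadicIndex k)

/-- Floor division by two of an index gives the index of the parent cell; the nesting of generations
rests on this. -/
theorem dyadicIndex_succ_div_two (k : ℕ) (x : Fin n → ℝ) :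
    (fun i => dyadicIndex a ρ (k + 1) x i / 2) = dyadicIndex a ρ k x := by
  ext i
  have := Int.floor_div_natCast (2 ^ (k + 1) * ((x i - a i) / ρ)) 2
  simp only [dyadicIndex]
  rw [Nat.cast_ofNat, Nat.cast_ofNat] at this
  rw [← this]
  congr 1
  ring

theorem dyadicIndex_eq_of_le {j k : ℕ} (hjk : j ≤ k) {x y : Fin n → ℝ}
    (h : dyadicIndex a ρ k x = dyadicIndex a ρ k y) :
    dyadicIndex a ρ j x = dyadicIndex a ρ j y := by
  induction k, hjk using Nat.le_induction with
  | base => exact h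
  | succ k _ ih =>
    refine ih ?_
    rw [← dyadicIndex_succ_div_two k x, ← dyadicIndex_succ_div_two k y, h]

theorem dyadicCell_subset_of_le {j k : ℕ} (hjk : j ≤ k) {x : Fin n → ℝ} {m : Fin n → ℤ}
    (hx : x ∈ dyadicCell a ρ k m) :
    dyadicCell a ρ k m ⊆ dyadicCell a ρ j (dyadicIndex a ρ j x) := fun _ hy =>
  dyadicIndex_eq_of_le hjk (Eq.trans hy (Eq.symm hx))

theorem dyadicCell_eq_pi (hρ : 0 < ρ) (k : ℕ) (m : Fin n → ℤ) :
    dyadicCell a ρ k m = Set.pi Set.univ fun i =>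
      Set.Ico (a i + m i * (ρ / 2 ^ k)) (a i + (m i + 1) * (ρ / 2 ^ k)) := by
  ext x
  simp only [dyadicCell, dyadicIndex, Set.mem_ofPred_eq, funext_iff, Int.floor_eq_iff, Set.mem_pi,
    Set.mem_univ, forall_true_left, Set.mem_Ico]
  refine forall_congr' fun i => ?_
  have h : (2 : ℝ) ^ k * ((x i - a i) / ρ) = (x i - a i) / (ρ / 2 ^ k) := by field_simp
  have hk : 0 < ρ / 2 ^ k := by positivity
  rw [h, le_div_iff₀ hk, div_lt_iff₀ hk]
  constructor <;> rintro ⟨h1, h2⟩ <;> constructor <;> linarith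

theorem cube_dyadicCenter (k : ℕ) (m : Fin n → ℤ) :
    cube (dyadicCenter a ρ k m) (ρ / 2 ^ k) = Set.Icc (fun i => a i + m i * (ρ / 2 ^ k))
      (fun i => a i + (m i + 1) * (ρ / 2 ^ k)) := by
  ext x
  simp only [cube, dyadicCenter, Set.mem_ofPred_eq, Set.mem_Icc, Pi.le_def, abs_le, ← forall_and]
  refine forall_congr' fun i => ?_
  constructor <;> rintro ⟨h1, h2⟩ <;> constructor <;> linarith

theorem dyadicCell_subset_cube (hρ : 0 < ρ) (k : ℕ) (m : Fin n → ℤ) :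
    dyadicCell a ρ k m ⊆ cube (dyadicCenter a ρ k m) (ρ / 2 ^ k) := by
  rw [cube_dyadicCenter, dyadicCell_eq_pi hρ, ← Set.pi_univ_Icc]
  exact Set.pi_mono fun i _ => Set.Ico_subset_Icc_self

theorem dyadicCell_ae_eq_cube (hρ : 0 < ρ) (k : ℕ) (m : Fin n → ℤ) :
    dyadicCell a ρ k m =ᵐ[volume] cube (dyadicCenter a ρ k m) (ρ / 2 ^ k) := by
  rw [cube_dyadicCenter, dyadicCell_eq_pi hρ]
  exact Measure.univ_pi_Ico_ae_eq_Icc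

theorem volume_dyadicCell (hρ : 0 < ρ) (k : ℕ) (m : Fin n → ℤ) :
    volume (dyadicCell a ρ k m) = ENNReal.ofReal ((ρ / 2 ^ k) ^ n) := by
  rw [dyadicCell_eq_pi hρ, Real.volume_pi_Ico]
  simp only [add_mul, one_mul, add_sub_add_left_eq_sub, add_sub_cancel_left, Finset.prod_const,
    Finset.card_univ, Fintype.card_fin]
  rw [ENNReal.ofReal_pow (by positivity)]

theorem volume_dyadicCell_ne_zero (hρ : 0 < ρ) (k : ℕ) (m : Fin n → ℤ) :
    volume (dyadicCell a ρ k m) ≠ 0 := by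
  rw [volume_dyadicCell hρ]; simp; positivity

theorem volume_dyadicCell_ne_top (hρ : 0 < ρ) (k : ℕ) (m : Fin n → ℤ) :
    volume (dyadicCell a ρ k m) ≠ ∞ := by
  rw [volume_dyadicCell hρ]; simp

theorem volume_dyadicCell_le_succ (hρ : 0 < ρ) (k : ℕ) (m m' : Fin n → ℤ) :
    volume (dyadicCell a ρ k m) = 2 ^ n * volume (dyadicCell a ρ (k + 1) m') := by
  rw [volume_dyadicCell hρ, volume_dyadicCell hρ, ← ENNReal.ofReal_ofNat 2,
    ← ENNReal.ofReal_pow (by norm_num), ← ENNReal.ofReal_mul (by positivity), ← mul_pow]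
  congr 2
  field_simp
  ring

theorem measure_dyadicCell_eq (μ : Measure (Fin n → ℝ)) (hρ : 0 < ρ) (k : ℕ) (m : Fin n → ℤ) :
    μ (dyadicCell a ρ k m) = dyadicAverage μ a ρ k m * volume (dyadicCell a ρ k m) :=
  (ENNReal.div_mul_cancel (volume_dyadicCell_ne_zero hρ k m)
    (volume_dyadicCell_ne_top hρ k m)).symm

variable {w : (Fin n → ℝ) → ℝ}

theorem weightMeasure_dyadicCell (hρ : 0 < ρ) (k : ℕ) (m : Fin n → ℤ) :
    weightMeasure w (dyadicCell a ρ k m) =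
      weightMeasure w (cube (dyadicCenter a ρ k m) (ρ / 2 ^ k)) :=
  measure_congr ((withDensity_absolutelyContinuous _ _).ae_eq (dyadicCell_ae_eq_cube hρ k m))

/-- Lebesgue differentiation along the closed cells containing `x`. They are not centred at `x`, so
the version for uniformly locally doubling measures is applied. -/
theorem ae_ofReal_le_dyadicMaximal (hw : IsWeight w) (hρ : 0 < ρ) :
    ∀ᵐ x, ENNReal.ofReal (w x) ≤ dyadicMaximal (weightMeasure w) a ρ x := by
  filter_upwards [IsUnifLocDoublingMeasure.ae_tendsto_average
    (volume : Measure (Fin n → ℝ)) hw.locallyIntegrable 1] with x hx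
  have hδ : Tendsto (fun k : ℕ => ρ / 2 ^ k / 2) atTop (𝓝[>] 0) := by
    rw [tendsto_nhdsWithin_iff]
    refine ⟨?_, Eventually.of_forall fun k => by simp only [Set.mem_Ioi]; positivity⟩
    have := (tendsto_pow_atTop_nhds_zero_of_lt_one (r := (1 / 2 : ℝ)) (by norm_num)
      (by norm_num)).const_mul (ρ / 2)
    rw [mul_zero] at this
    refine this.congr fun k => ?_
    rw [one_div, inv_pow]; ring
  have h := hx (fun k => dyadicCenter a ρ k (dyadicIndex a ρ k x)) _ hδ
    (Eventually.of_forall fun k => by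
      rw [one_mul, ← cube_eq_closedBall _ (by positivity)]
      exact dyadicCell_subset_cube hρ k _ rfl)
  refine le_of_tendsto' (ENNReal.tendsto_ofReal h) fun k => ?_
  rw [ofReal_setAverage
    (hw.locallyIntegrable.integrableOn_isCompact (isCompact_closedBall _ _))
    (Eventually.of_forall hw.nonneg), ← withDensity_apply _ Metric.isClosed_closedBall.measurableSet,
    ← cube_eq_closedBall _ (by positivity)]
  refine le_trans (le_of_eq ?_) (le_iSup _ k)
  rw [dyadicAverage, weightMeasure_dyadicCell hρ, measure_congr (dyadicCell_ae_eq_cube hρ k _)]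
  rfl

/-- Averages of the restriction of a weight to a measurable set are bounded by its maximal function. -/
theorem weightMeasure_inter_div_le_maximalFunction (hw : IsWeight w) {S : Set (Fin n → ℝ)}
    (hS : MeasurableSet S) {c : Fin n → ℝ} {r : ℝ} (hr : 0 < r) {x : Fin n → ℝ}
    (hx : x ∈ cube c r) :
    weightMeasure w (cube c r ∩ S) / volume (cube c r) ≤
      maximalFunction volume (S.indicator w) x := by
  refine le_trans (le_of_eq ?_) (le_iSup₂_of_le c r (le_iSup₂_of_le hr hx le_rfl))
  congr 1
  have : ∀ y, ‖S.indicator w y‖ₑ = S.indicator (fun y => ENNReal.ofReal (w y)) y := fun y => by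
    by_cases hy : y ∈ S
    · simp [hy, Real.enorm_eq_ofReal (hw.nonneg y)]
    · simp [hy]
  simp_rw [this]
  rw [setLIntegral_indicator hS, weightMeasure,
    withDensity_apply _ ((measurableSet_cube c hr.le).inter hS), Set.inter_comm]

/-- On a cell whose average exceeds those of its ancestors, the dyadic maximal function is
controlled by the maximal function of the localized weight. -/
theorem setLIntegral_dyadicMaximal_le (hw : IsWeight w) (hρ : 0 < ρ) {K : ℝ≥0∞}
    (hK : ∀ (c : Fin n → ℝ) (r : ℝ), 0 < r →
      ∫⁻ x in cube c r, maximalFunction volume ((cube c r).indicator w) x ≤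
        K * weightMeasure w (cube c r))
    (k : ℕ) (m : Fin n → ℤ)
    (h : ∀ x ∈ dyadicCell a ρ k m, ∀ j < k, dyadicAverage (weightMeasure w) a ρ j
      (dyadicIndex a ρ j x) ≤ dyadicAverage (weightMeasure w) a ρ k m) :
    ∫⁻ x in dyadicCell a ρ k m, dyadicMaximal (weightMeasure w) a ρ x ≤
      K * weightMeasure w (dyadicCell a ρ k m) := by
  set Q := cube (dyadicCenter a ρ k m) (ρ / 2 ^ k) with hQ
  calc _ ≤ ∫⁻ x in dyadicCell a ρ k m, maximalFunction volume (Q.indicator w) x := by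
        refine setLIntegral_mono' (measurableSet_dyadicCell k m) fun x hx => iSup_le fun j => ?_
        -- Cells of generation at least `k` lie in `Q`, so their averages see only `w χ_Q`; coarser
        -- averages are dominated by that of generation `k` through `h`.
        have key : ∀ i, k ≤ i → dyadicAverage (weightMeasure w) a ρ i (dyadicIndex a ρ i x) ≤
            maximalFunction volume (Q.indicator w) x := fun i hi => by
          refine le_trans ?_ (weightMeasure_inter_div_le_maximalFunction hw
            (measurableSet_cube _ (by positivity)) (by positivity)
            (dyadicCell_subset_cube hρ i (dyadicIndex a ρ i x) rfl))
          rw [dyadicAverage, measure_congr (dyadicCell_ae_eq_cube hρ i _)]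
          gcongr
          refine Set.subset_inter (dyadicCell_subset_cube hρ i _) ?_
          have hx' : dyadicIndex a ρ k x = m := hx
          refine (dyadicCell_subset_of_le hi (x := x) rfl).trans ?_
          rw [hx']
          exact dyadicCell_subset_cube hρ k m
        rcases lt_or_ge j k with hj | hj
        · have := key k le_rfl
          rw [show dyadicIndex a ρ k x = m from hx] at this
          exact (h x hx j hj).trans this
        · exact key j hj
    _ = ∫⁻ x in Q, maximalFunction volume (Q.indicator w) x :=
        setLIntegral_congr (dyadicCell_ae_eq_cube hρ k m)
    _ ≤ K * weightMeasure w Q := hK _ _ (by positivity)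
    _ = _ := by rw [weightMeasure_dyadicCell hρ]

/-- Integrating over a level set of the dyadic maximal function, decomposed into the maximal cells
on which the average exceeds the level. -/
theorem setLIntegral_dyadicMaximal_levelSet_le (hw : IsWeight w) (hρ : 0 < ρ) {K : ℝ≥0∞}
    (hK : ∀ (c : Fin n → ℝ) (r : ℝ), 0 < r →
      ∫⁻ x in cube c r, maximalFunction volume ((cube c r).indicator w) x ≤
        K * weightMeasure w (cube c r))
    {t : ℝ≥0∞} (ht : dyadicAverage (weightMeasure w) a ρ 0 0 ≤ t) :
    ∫⁻ x in dyadicCell a ρ 0 0 ∩ {x | t < dyadicMaximal (weightMeasure w) a ρ x},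
        dyadicMaximal (weightMeasure w) a ρ x ≤
      K * 2 ^ n * t *
        volume (dyadicCell a ρ 0 0 ∩ {x | t < dyadicMaximal (weightMeasure w) a ρ x}) := by
  classical
  set μ := weightMeasure w
  -- Stopping-time pieces: `B (k, m)` collects the points whose first generation with average above
  -- `t` is `k`, in cell `m`. The condition depends only on the cell and its ancestors, so a
  -- nonempty piece is a whole cell.
  let B : ℕ × (Fin n → ℤ) → Set (Fin n → ℝ) := fun p => {x | x ∈ dyadicCell a ρ 0 0 ∧
    dyadicIndex a ρ p.1 x = p.2 ∧ t < dyadicAverage μ a ρ p.1 p.2 ∧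
    ∀ j < p.1, dyadicAverage μ a ρ j (dyadicIndex a ρ j x) ≤ t}
  have hB : ∀ p, (B p).Nonempty → B p = dyadicCell a ρ p.1 p.2 := by
    rintro ⟨k, m⟩ ⟨x, hx0, hxm, hxt, hxj⟩
    refine Set.Subset.antisymm (fun y hy => hy.2.1) fun y hy => ?_
    have hidx : ∀ j ≤ k, dyadicIndex a ρ j y = dyadicIndex a ρ j x := fun j hj =>
      dyadicIndex_eq_of_le hj (Eq.trans hy hxm.symm)
    exact ⟨(hidx 0 k.zero_le).trans hx0, hy, hxt, fun j hj => by rw [hidx j hj.le]; exact hxj j hj⟩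
  have hBm : ∀ p, MeasurableSet (B p) := fun p => by
    rcases (B p).eq_empty_or_nonempty with h | h
    · rw [h]; exact MeasurableSet.empty
    · rw [hB p h]; exact measurableSet_dyadicCell _ _
  have hBd : Pairwise (Function.onFun Disjoint B) := by
    rintro ⟨k, m⟩ ⟨k', m'⟩ hne
    refine Set.disjoint_left.2 ?_
    rintro x ⟨-, hm, hkt, hkj⟩ ⟨-, hm', hkt', hkj'⟩
    dsimp only at hm hkt hkj hm' hkt' hkj'
    rcases lt_trichotomy k k' with h | rfl | h
    · exact absurd (hkj' k h) (by rw [hm]; exact hkt.not_ge)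
    · exact hne (by rw [← hm, ← hm'])
    · exact absurd (hkj k' h) (by rw [hm']; exact hkt'.not_ge)
  have hU : dyadicCell a ρ 0 0 ∩ {x | t < dyadicMaximal μ a ρ x} = ⋃ p, B p := by
    ext x
    simp only [Set.mem_inter_iff, Set.mem_ofPred_eq, Set.mem_iUnion]
    constructor
    · rintro ⟨hx0, hx⟩
      have hex : ∃ k, t < dyadicAverage μ a ρ k (dyadicIndex a ρ k x) := lt_iSup_iff.1 hx
      exact ⟨⟨Nat.find hex, _⟩, hx0, rfl, Nat.find_spec hex, fun j hj =>
        not_lt.1 (Nat.find_min hex hj)⟩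
    · rintro ⟨⟨k, m⟩, hx0, hm, hxt, -⟩
      dsimp only at hm hxt
      rw [← hm] at hxt
      exact ⟨hx0, hxt.trans_le (le_iSup (fun k => dyadicAverage μ a ρ k (dyadicIndex a ρ k x)) k)⟩
  rw [hU, lintegral_iUnion hBm hBd, measure_iUnion hBd hBm, ← ENNReal.tsum_mul_left]
  refine ENNReal.tsum_le_tsum fun p => ?_
  rcases (B p).eq_empty_or_nonempty with h | h
  · simp [h]
  have hBp := hB p h
  obtain ⟨k, m⟩ := p
  rw [hBp]
  obtain ⟨x, hx0, hxm, hxt, hxj⟩ := h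
  dsimp only at hxm hxt hxj ⊢
  have hsub : ∀ y ∈ dyadicCell a ρ k m, ∀ j < k, dyadicAverage μ a ρ j (dyadicIndex a ρ j y) ≤ t :=
    fun y hy => by rw [← hBp] at hy; exact hy.2.2.2
  refine (setLIntegral_dyadicMaximal_le hw hρ hK k m
    fun y hy j hj => (hsub y hy j hj).trans hxt.le).trans ?_
  rw [mul_assoc, mul_assoc]
  gcongr
  -- The root is never selected, as its average is at most `t`. Any other selected cell has a parent
  -- that was passed over, with average at most `t` and `2 ^ n` times the volume.
  rcases k with _ | k
  · have : m = 0 := by rw [← hxm]; exact hx0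
    subst this
    exact absurd hxt ht.not_gt
  calc μ (dyadicCell a ρ (k + 1) m) ≤ μ (dyadicCell a ρ k (dyadicIndex a ρ k x)) :=
        measure_mono (dyadicCell_subset_of_le k.le_succ hxm)
    _ ≤ t * volume (dyadicCell a ρ k (dyadicIndex a ρ k x)) := by
        rw [measure_dyadicCell_eq μ hρ]; gcongr; exact hxj k k.lt_succ_self
    _ = _ := by rw [volume_dyadicCell_le_succ hρ k _ m]; ring

end Dyadic

/-! ### From the Fujii–Wilson constant to a power modulus -/

/-- If the integral of `f` over `{t < f}` is controlled by the Chebyshev lower bound at every level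
`t ≥ t₀`, the integrals over the level sets accumulate over dyadic levels. -/
theorem nat_mul_setLIntegral_levelSet_le {X : Type*} [MeasurableSpace X] {ν : Measure X}
    {f : X → ℝ≥0∞} (hf : Measurable f) {K t₀ : ℝ≥0∞}
    (h : ∀ t, t₀ ≤ t → ∫⁻ x in {x | t < f x}, f x ∂ν ≤ K * t * ν {x | t < f x}) (N : ℕ)
    (t : ℝ≥0∞) (ht : t₀ ≤ t) :
    N * ∫⁻ x in {x | 2 ^ N * t < f x}, f x ∂ν + 2 * K * t * ν {x | t < f x} ≤
      2 * K * ∫⁻ x in {x | t < f x}, f x ∂ν := by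
  have hm : ∀ t, MeasurableSet {x | t < f x} := fun t => measurableSet_lt measurable_const hf
  have cheb : ∀ (t : ℝ≥0∞) (S : Set X), MeasurableSet S → (∀ x ∈ S, t < f x) →
      t * ν S ≤ ∫⁻ x in S, f x ∂ν := fun t S hS hSt => by
    rw [← setLIntegral_const]
    exact setLIntegral_mono' hS fun x hx => (hSt x hx).le
  induction N generalizing t with
  | zero =>
    simp only [Nat.cast_zero, zero_mul, zero_add, mul_assoc]
    gcongr
    exact cheb t _ (hm t) fun x hx => hx
  | succ N ih =>
    have ht2 : t ≤ 2 * t := by rw [two_mul]; exact le_self_add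
    have hsub : {x | 2 * t < f x} ⊆ {x | t < f x} := fun x hx => ht2.trans_lt hx
    have h1 := ih (2 * t) (ht.trans ht2)
    have h2 := h (2 * t) (ht.trans ht2)
    have hpow : 2 ^ N * (2 * t) = 2 ^ (N + 1) * t := by rw [pow_succ]; ring
    rw [hpow] at h1
    have h3 : ∫⁻ x in {x | 2 ^ (N + 1) * t < f x}, f x ∂ν ≤
        ∫⁻ x in {x | 2 * t < f x}, f x ∂ν := by
      refine lintegral_mono_set fun x (hx : _ < _) => (lt_of_le_of_lt ?_ hx : 2 * t < f x)
      rw [← hpow]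
      exact le_mul_of_one_le_left zero_le (one_le_pow₀ (by norm_num))
    have h4 := cheb t ({x | t < f x} \ {x | 2 * t < f x}) ((hm _).diff (hm _)) fun x hx => hx.1
    have h5 : ∫⁻ x in {x | t < f x}, f x ∂ν = ∫⁻ x in {x | 2 * t < f x}, f x ∂ν +
        ∫⁻ x in {x | t < f x} \ {x | 2 * t < f x}, f x ∂ν := by
      rw [← lintegral_inter_add_sdiff _ {x | t < f x} (hm (2 * t)), Set.inter_eq_right.2 hsub]
    have h6 : ν {x | t < f x} = ν {x | 2 * t < f x} + ν ({x | t < f x} \ {x | 2 * t < f x}) := by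
      rw [← measure_inter_add_sdiff {x | t < f x} (hm (2 * t)), Set.inter_eq_right.2 hsub]
    rw [h5, h6]
    set F := ∫⁻ x in {x | 2 ^ (N + 1) * t < f x}, f x ∂ν
    set G := ∫⁻ x in {x | 2 * t < f x}, f x ∂ν
    -- The extra copy of `F` costs `K * (2 * t) * ν {2 * t < f}`, exactly what raises the
    -- coefficient `2 * K * t` to the `2 * K * (2 * t)` of the induction hypothesis at level `2 *
    -- t`. The layer between `t` and `2 * t` is handled by Chebyshev.
    calc _ = N * F + F + 2 * K * t * ν {x | 2 * t < f x} +
          2 * K * (t * ν ({x | t < f x} \ {x | 2 * t < f x})) := by push_cast; ring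
      _ ≤ N * F + K * (2 * t) * ν {x | 2 * t < f x} + 2 * K * t * ν {x | 2 * t < f x} +
          2 * K * (t * ν ({x | t < f x} \ {x | 2 * t < f x})) := by
          gcongr
          exact h3.trans h2
      _ = N * F + 2 * K * (2 * t) * ν {x | 2 * t < f x} +
          2 * K * (t * ν ({x | t < f x} \ {x | 2 * t < f x})) := by ring
      _ ≤ 2 * K * G + 2 * K * ∫⁻ x in {x | t < f x} \ {x | 2 * t < f x}, f x ∂ν := by
          gcongr
      _ = _ := by ring

/-- Accumulating over `N ≥ 4 * K` doublings gives `N ∫_{2^N t < f} f ≤ 2 K ∫_{t < f} f`, so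
multiplying the level by `2 ^ N` at least halves the integral. Cancelling `2 * K` needs no
finiteness of the integrals. -/
theorem two_pow_mul_setLIntegral_levelSet_le {X : Type*} [MeasurableSpace X] {ν : Measure X}
    {f : X → ℝ≥0∞} (hf : Measurable f) {K t₀ : ℝ≥0∞} (hK0 : K ≠ 0) (hK : K ≠ ∞)
    (h : ∀ t, t₀ ≤ t → ∫⁻ x in {x | t < f x}, f x ∂ν ≤ K * t * ν {x | t < f x}) {N : ℕ}
    (hN : 4 * K ≤ N) (k : ℕ) :
    2 ^ k * ∫⁻ x in {x | (2 ^ N) ^ k * t₀ < f x}, f x ∂ν ≤ ∫⁻ x in {x | t₀ < f x}, f x ∂ν := by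
  have half : ∀ t, t₀ ≤ t → 2 * ∫⁻ x in {x | 2 ^ N * t < f x}, f x ∂ν ≤
      ∫⁻ x in {x | t < f x}, f x ∂ν := fun t ht => by
    have h1 := le_self_add.trans (nat_mul_setLIntegral_levelSet_le hf h N t ht)
    have h2 : 2 * K * (2 * ∫⁻ x in {x | 2 ^ N * t < f x}, f x ∂ν) ≤
        2 * K * ∫⁻ x in {x | t < f x}, f x ∂ν := by
      refine le_trans ?_ h1
      rw [← mul_assoc]
      gcongr
      exact le_trans (le_of_eq (by ring)) hN
    exact (ENNReal.mul_le_mul_iff_right (mul_ne_zero two_ne_zero hK0)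
      (ENNReal.mul_ne_top ENNReal.ofNat_ne_top hK)).1 h2
  induction k with
  | zero => simp
  | succ k ih =>
    refine le_trans ?_ ih
    have := half ((2 ^ N) ^ k * t₀) (le_mul_of_one_le_left zero_le
      (one_le_pow₀ (one_le_pow₀ (by norm_num))))
    rw [← mul_assoc, ← pow_succ'] at this
    rw [pow_succ, mul_assoc]
    gcongr

/-- The quantitative absolute continuity of a weight on a cube, before the choice of the level. -/
theorem weightMeasure_le_of_volume_le {n : ℕ} {w : (Fin n → ℝ) → ℝ} (hw : IsWeight w)
    {K : ℝ≥0∞} (hK1 : K ≠ 0) (hKtop : K ≠ ∞)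
    (hK : ∀ (c : Fin n → ℝ) (r : ℝ), 0 < r →
      ∫⁻ x in cube c r, maximalFunction volume ((cube c r).indicator w) x ≤
        K * weightMeasure w (cube c r)) {N : ℕ} (hN : 4 * (K * 2 ^ n) ≤ N)
    (c : Fin n → ℝ) {r : ℝ} (hr : 0 < r) {A : Set (Fin n → ℝ)} (hA : MeasurableSet A)
    (hAQ : A ⊆ cube c r) {s : ℝ≥0∞} (hs : volume A ≤ s * volume (cube c r)) (k : ℕ) :
    weightMeasure w A ≤ ((2 ^ N) ^ k * s + K / 2 ^ k) * weightMeasure w (cube c r) := by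
  set μ := weightMeasure w with hμ
  let a : Fin n → ℝ := fun i => c i - r / 2
  have hc : dyadicCenter a r 0 0 = c := by
    ext i; simp only [dyadicCenter, a, Pi.zero_apply, Int.cast_zero, pow_zero]; ring
  set Q := dyadicCell a r 0 0 with hQ
  have hQae : Q =ᵐ[volume] cube c r := by
    have := dyadicCell_ae_eq_cube (a := a) hr 0 0
    rwa [hc, pow_zero, div_one] at this
  have hQm : MeasurableSet Q := measurableSet_dyadicCell 0 0
  have hac : μ ≪ volume := withDensity_absolutelyContinuous _ _
  have hμQ : μ Q = μ (cube c r) := measure_congr (hac.ae_eq hQae)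
  set f := dyadicMaximal μ a r
  have hf : Measurable f := measurable_dyadicMaximal μ
  set t₀ := dyadicAverage μ a r 0 0
  have hm : ∀ t, MeasurableSet {x | t < f x} := fun t => measurableSet_lt measurable_const hf
  have hlev := two_pow_mul_setLIntegral_levelSet_le (ν := volume.restrict Q) hf (K := K * 2 ^ n)
    (t₀ := t₀) (mul_ne_zero hK1 (by simp)) (ENNReal.mul_ne_top hKtop (by simp))
    (fun t ht => by
      rw [Measure.restrict_restrict (hm t), Measure.restrict_apply (hm t), Set.inter_comm]
      exact setLIntegral_dyadicMaximal_levelSet_le hw hr hK ht) hN k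
  have htotal : ∫⁻ x in Q, f x ≤ K * μ Q :=
    setLIntegral_dyadicMaximal_le hw hr hK 0 0 (by simp)
  set t := (2 ^ N) ^ k * t₀ with ht
  have hF : ∫⁻ x in {x | t < f x}, f x ∂(volume.restrict Q) ≤ K * μ Q / 2 ^ k := by
    rw [ENNReal.le_div_iff_mul_le (by simp) (by simp), mul_comm]
    exact hlev.trans ((setLIntegral_le_lintegral _ _).trans htotal)
  have hAE : μ A = μ (A ∩ Q) := measure_congr (hac.ae_eq (by
    filter_upwards [hQae] with x hx
    have hx' : x ∈ Q ↔ x ∈ cube c r := Iff.of_eq hx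
    exact propext ⟨fun h => ⟨h, hx'.2 (hAQ h)⟩, fun h => h.1⟩))
  rw [hAE, ← hμQ]
  calc μ (A ∩ Q) = ∫⁻ x in A ∩ Q, ENNReal.ofReal (w x) := by
        rw [hμ, weightMeasure, withDensity_apply _ (hA.inter hQm)]
    _ ≤ ∫⁻ x in A ∩ Q, f x :=
        setLIntegral_mono_ae hf.aemeasurable
          ((ae_ofReal_le_dyadicMaximal hw hr).mono fun x hx _ => hx)
    -- Below level `t = (2 ^ N) ^ k * t₀` the integral is controlled by the volume of `A`; above it,
    -- by the factor `2 ^ (-k)`.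
    _ ≤ ∫⁻ x in A ∩ Q, (t + {x | t < f x}.indicator f x) := by
        refine lintegral_mono fun x => ?_
        by_cases hx : t < f x
        · rw [Set.indicator_of_mem (by exact hx)]; exact le_add_self
        · exact (not_lt.1 hx).trans le_self_add
    _ = t * volume (A ∩ Q) + ∫⁻ x in A ∩ Q, {x | t < f x}.indicator f x := by
        rw [lintegral_add_left measurable_const, setLIntegral_const]
    _ ≤ t * volume A + K * μ Q / 2 ^ k := by
        gcongr
        · exact Set.inter_subset_left
        · refine (lintegral_mono_set Set.inter_subset_right).trans ?_
          rwa [lintegral_indicator (hm t)]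
    _ ≤ t * (s * volume Q) + K * μ Q / 2 ^ k := by
        gcongr
        rwa [measure_congr hQae]
    _ = _ := by
        rw [hQ, measure_dyadicCell_eq μ hr, ht, ENNReal.div_eq_inv_mul, ENNReal.div_eq_inv_mul]
        ring

/-- The `A_∞` property of a measure on `ℝⁿ`: on every cube it is absolutely continuous with respect
to Lebesgue measure with a power-type modulus. -/
def HasPowerModulus {n : ℕ} (μ : Measure (Fin n → ℝ)) (C c : ℝ) : Prop :=
  ∀ (x : Fin n → ℝ) (ρ : ℝ), 0 < ρ → ∀ A : Set (Fin n → ℝ), MeasurableSet A →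
    A ⊆ Metric.closedBall x ρ → ∀ s : ℝ, 0 < s →
    volume A ≤ ENNReal.ofReal s * volume (Metric.closedBall x ρ) →
    μ A ≤ ENNReal.ofReal (C * s ^ c) * μ (Metric.closedBall x ρ)

/-- Choosing the level: `(2 ^ N) ^ k * s + K / 2 ^ k` is at most a power of `s` for a suitable `k`. -/
theorem exists_pow_mul_add_div_le {N : ℕ} (hN : 0 < N) {K s : ℝ} (hK : 0 ≤ K) (hs : 0 < s)
    (hs1 : s ≤ 1) :
    ∃ k : ℕ, (2 ^ N) ^ k * s + K / 2 ^ k ≤ (1 + 2 * K) * s ^ (1 / (2 * N) : ℝ) := by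
  have hNr : (1 : ℝ) ≤ N := by exact_mod_cast hN
  have hΛ : (1 : ℝ) < 2 ^ (2 * N) := one_lt_pow₀ (by norm_num) (by omega)
  -- Take `k` with `2 ^ (2 N k) ≤ 1 / s < 2 ^ (2 N (k + 1))`: the first term is then at most `√s`,
  -- and `2 ^ (-k)` at most `2 s ^ (1 / (2 N))`.
  obtain ⟨k, hk1, hk2⟩ := exists_nat_pow_near ((one_le_div hs).2 hs1) hΛ
  refine ⟨k, ?_⟩
  set c : ℝ := 1 / (2 * N) with hc
  have hc0 : 0 < c := by positivity
  have hpow : ∀ j : ℕ, (((2 : ℝ) ^ (2 * N)) ^ j) ^ c = 2 ^ j := fun j => by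
    rw [← pow_mul, mul_comm (2 * N) j, pow_mul, ← Real.rpow_natCast _ (2 * N),
      ← Real.rpow_mul (by positivity)]
    push_cast
    rw [hc, mul_one_div_cancel (by positivity), Real.rpow_one]
  have h2 : 1 / (2 : ℝ) ^ k ≤ 2 * s ^ c := by
    have := Real.rpow_le_rpow (by positivity) hk2.le hc0.le
    rw [hpow, Real.div_rpow zero_le_one hs.le, Real.one_rpow, div_le_iff₀ (by positivity)] at this
    rw [div_le_iff₀ (by positivity)]
    calc (1 : ℝ) ≤ _ := this
      _ = _ := by rw [pow_succ]; ring
  have h1 : ((2 : ℝ) ^ N) ^ k * s ≤ s ^ c := by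
    have h3 : (((2 : ℝ) ^ N) ^ k * s) ^ 2 ≤ s := by
      have : (((2 : ℝ) ^ N) ^ k) ^ 2 = (2 ^ (2 * N)) ^ k := by
        rw [← pow_mul, ← pow_mul, ← pow_mul]; congr 1; ring
      rw [mul_pow, this]
      rw [le_div_iff₀ hs] at hk1
      nlinarith
    calc _ ≤ Real.sqrt s := Real.le_sqrt_of_sq_le h3
      _ = s ^ (1 / 2 : ℝ) := Real.sqrt_eq_rpow s
      _ ≤ s ^ c := Real.rpow_le_rpow_of_exponent_ge hs hs1 (by
          rw [hc]; exact one_div_le_one_div_of_le (by norm_num) (by linarith))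
  calc _ = ((2 : ℝ) ^ N) ^ k * s + K * (1 / 2 ^ k) := by ring
    _ ≤ s ^ c + K * (2 * s ^ c) := by gcongr
    _ = _ := by ring

/-- The constant enters only through `∫_Q M(w χ_Q) ≤ K w(Q)` on all cubes. The resulting exponent is
`1 / (2 N)` for an integer `N > 4 K 2 ^ n`; for `s > 1` the bound is trivial. -/
theorem IsAInfty.exists_hasPowerModulus {n : ℕ} {w : (Fin n → ℝ) → ℝ} (hw : IsAInfty w) :
    ∃ C c : ℝ, 1 ≤ C ∧ 0 < c ∧ HasPowerModulus (weightMeasure w) C c := by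
  set K₀ := fujiiWilsonConst w with hK₀
  have hK₀top : K₀ ≠ ∞ := hw.const_lt_top.ne
  set K := max K₀ 1
  have hKtop : K ≠ ∞ := by simp [K, hK₀top]
  have hK1 : K ≠ 0 := (zero_lt_one.trans_le (le_max_right _ _)).ne'
  have hK : ∀ (c : Fin n → ℝ) (r : ℝ), 0 < r →
      ∫⁻ x in cube c r, maximalFunction volume ((cube c r).indicator w) x ≤
        K * weightMeasure w (cube c r) := fun c r hr => by
    have h : (∫⁻ x in cube c r, maximalFunction volume ((cube c r).indicator w) x) /
        weightMeasure w (cube c r) ≤ K :=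
      (le_iSup₂_of_le c r (le_iSup_of_le hr le_rfl) : _ ≤ K₀).trans (le_max_left _ _)
    refine (ENNReal.div_le_iff_le_mul (Or.inr hKtop) (Or.inl ?_)).1 h
    rw [cube_eq_closedBall c hr.le]
    exact (weightMeasure_apply_lt_top_of_isCompact hw.isWeight (isCompact_closedBall _ _)).ne
  obtain ⟨N, hN⟩ := ENNReal.exists_nat_gt (r := 4 * (K * 2 ^ n))
    (ENNReal.mul_ne_top (by simp) (ENNReal.mul_ne_top hKtop (by simp)))
  have hN0 : 0 < N := Nat.pos_of_ne_zero fun h => by simp [h] at hN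
  refine ⟨1 + 2 * K.toReal, 1 / (2 * N), by simp, by positivity, ?_⟩
  intro x ρ hρ A hA hAQ s hs hvol
  have hcube : cube x (2 * ρ) = Metric.closedBall x ρ := by
    rw [cube_eq_closedBall x (by positivity)]; congr 1; ring
  rcases le_or_gt s 1 with hs1 | hs1
  · obtain ⟨k, hk⟩ := exists_pow_mul_add_div_le hN0 (K := K.toReal) ENNReal.toReal_nonneg hs hs1
    rw [← hcube] at hAQ hvol ⊢
    refine (weightMeasure_le_of_volume_le hw.isWeight hK1 hKtop hK hN.le x (by positivity) hA hAQ
      hvol k).trans ?_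
    gcongr
    refine le_trans (le_of_eq ?_) (ENNReal.ofReal_le_ofReal hk)
    rw [ENNReal.ofReal_add (by positivity) (by positivity), ENNReal.ofReal_mul (by positivity),
      ENNReal.ofReal_div_of_pos (by positivity), ENNReal.ofReal_toReal hKtop]
    simp [ENNReal.ofReal_pow]
  · calc _ ≤ 1 * weightMeasure w (Metric.closedBall x ρ) := by
          rw [one_mul]; exact measure_mono hAQ
      _ ≤ _ := by
          gcongr
          rw [ENNReal.one_le_ofReal]
          have h1 : 1 ≤ s ^ (1 / (2 * N) : ℝ) := Real.one_le_rpow hs1.le (by positivity)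
          have h2 : 0 ≤ K.toReal := ENNReal.toReal_nonneg
          nlinarith

/-! ### Thin shells, doubling and dilation for measures with a power modulus -/

section PowerModulus

variable {n : ℕ} {μ : Measure (Fin n → ℝ)} {C c : ℝ}

/-- A power modulus makes thin shells between cubes of comparable size negligible. -/
theorem HasPowerModulus.exists_measure_sdiff_le (h : HasPowerModulus μ C c) (hC : 1 ≤ C)
    (hc : 0 < c) {ε : ℝ} (hε : 0 < ε) :
    ∃ q : ℝ, 1 < q ∧ ∀ (x y : Fin n → ℝ) (ρ σ : ℝ), 0 < σ → σ ≤ ρ → ρ ≤ q * σ →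
      dist y x ≤ ρ - σ → μ (Metric.closedBall x ρ \ Metric.closedBall y σ) ≤
        ENNReal.ofReal ε * μ (Metric.closedBall x ρ) := by
  set s : ℝ := (ε / C) ^ (1 / c) with hs
  have hC0 : 0 < C := by linarith
  have hs0 : 0 < s := by positivity
  have hsc : C * s ^ c = ε := by
    rw [hs, ← Real.rpow_mul (by positivity), one_div_mul_cancel hc.ne', Real.rpow_one]
    field_simp
  -- With `1 - σ / ρ ≤ s / (n + 1)`, Bernoulli bounds the relative volume of the shell by `n s / (n
  -- + 1) ≤ s`, and `s` solves `C s ^ c = ε`. The denominator `n + 1` also serves `n = 0`.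
  refine ⟨1 + s / (n + 1), by simp; positivity, fun x y ρ σ hσ hσρ hρq hd => ?_⟩
  have hρ : 0 < ρ := hσ.trans_le hσρ
  rw [← hsc]
  refine h x ρ hρ _ (Metric.isClosed_closedBall.measurableSet.diff
    Metric.isClosed_closedBall.measurableSet) Set.sdiff_subset s hs0 ?_
  have hsub : Metric.closedBall y σ ⊆ Metric.closedBall x ρ :=
    Metric.closedBall_subset_closedBall' (by linarith)
  rw [measure_sdiff hsub Metric.isClosed_closedBall.measurableSet.nullMeasurableSet
    measure_closedBall_lt_top.ne, Real.volume_pi_closedBall _ hρ.le,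
    Real.volume_pi_closedBall _ hσ.le, ← ENNReal.ofReal_sub _ (by positivity),
    ← ENNReal.ofReal_mul hs0.le, Fintype.card_fin]
  refine ENNReal.ofReal_le_ofReal ?_
  have hb := one_add_mul_le_pow (a := σ / ρ - 1) (by have : 0 < σ / ρ := by positivity
                                                     linarith) n
  rw [add_sub_cancel, div_pow, le_div_iff₀ (by positivity)] at hb
  have hσρ' : 1 - σ / ρ ≤ s / (n + 1) := by
    rw [one_sub_div hρ.ne', div_le_iff₀ hρ]
    have : 0 ≤ s / (n + 1) := by positivity
    nlinarith
  have hns : n * (1 - σ / ρ) ≤ s := by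
    calc (n : ℝ) * (1 - σ / ρ) ≤ n * (s / (n + 1)) := by gcongr
      _ ≤ s := by
        rw [mul_div_assoc', div_le_iff₀ (by positivity)]; nlinarith
  rw [mul_pow, mul_pow]
  have hρn : 0 < ρ ^ n := by positivity
  have : ρ ^ n - σ ^ n ≤ s * ρ ^ n := by nlinarith
  have h2 : (0 : ℝ) < 2 ^ n := by positivity
  nlinarith

/-- A measure with a power modulus is doubling, with a power-type bound for nested cubes. -/
theorem HasPowerModulus.exists_doubling [IsFiniteMeasureOnCompacts μ]
    (h : HasPowerModulus μ C c) (hC : 1 ≤ C) (hc : 0 < c) :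
    ∃ D d : ℝ, 1 ≤ D ∧ 0 < d ∧ ∀ (x y : Fin n → ℝ) (ρ σ : ℝ), 0 < σ → σ ≤ ρ →
      dist y x ≤ ρ - σ →
      μ (Metric.closedBall x ρ) ≤
        ENNReal.ofReal (D * (ρ / σ) ^ d) * μ (Metric.closedBall y σ) := by
  obtain ⟨q, hq, hshell⟩ := h.exists_measure_sdiff_le hC hc (ε := 1 / 2) (by norm_num)
  have step : ∀ (x y : Fin n → ℝ) (ρ σ : ℝ), 0 < σ → σ ≤ ρ → ρ ≤ q * σ →
      dist y x ≤ ρ - σ → μ (Metric.closedBall x ρ) ≤ 2 * μ (Metric.closedBall y σ) := by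
    intro x y ρ σ hσ hσρ hρq hd
    have hfin : ∀ z t, μ (Metric.closedBall z t) ≠ ∞ := fun z t =>
      (isCompact_closedBall z t).measure_lt_top.ne
    have h1 : μ (Metric.closedBall x ρ) ≤ μ (Metric.closedBall y σ) +
        ENNReal.ofReal (1 / 2) * μ (Metric.closedBall x ρ) :=
      (measure_le_inter_add_sdiff _ _ (Metric.closedBall y σ)).trans
        (add_le_add (measure_mono Set.inter_subset_right) (hshell x y ρ σ hσ hσρ hρq hd))
    rw [← ENNReal.toReal_le_toReal (hfin _ _) (ENNReal.mul_ne_top (by simp) (hfin _ _))]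
    rw [← ENNReal.toReal_le_toReal (hfin _ _) (ENNReal.add_ne_top.2 ⟨hfin _ _,
      ENNReal.mul_ne_top (by simp) (hfin _ _)⟩), ENNReal.toReal_add (hfin _ _)
      (ENNReal.mul_ne_top (by simp) (hfin _ _)), ENNReal.toReal_mul,
      ENNReal.toReal_ofReal (by norm_num)] at h1
    rw [ENNReal.toReal_mul, ENNReal.toReal_ofNat]
    linarith
  have chain : ∀ (N : ℕ) (x y : Fin n → ℝ) (ρ σ : ℝ), 0 < σ → σ ≤ ρ → ρ ≤ q ^ N * σ →
      dist y x ≤ ρ - σ → μ (Metric.closedBall x ρ) ≤ 2 ^ N * μ (Metric.closedBall y σ) := by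
    intro N
    induction N with
    | zero =>
      intro x y ρ σ hσ hσρ hρq hd
      have hρσ : ρ = σ := le_antisymm (by linarith) hσρ
      have hyx : y = x := dist_le_zero.1 (by linarith)
      simp [hρσ, hyx]
    | succ N ih =>
      intro x y ρ σ hσ hσρ hρq hd
      rcases le_or_gt ρ (q ^ N * σ) with hle | hlt
      · refine (ih x y ρ σ hσ hσρ hle hd).trans ?_
        gcongr
        · norm_num
        · omega
      have hqN : 1 ≤ q ^ N := one_le_pow₀ hq.le
      have hqN0 : 0 < q ^ N := by positivity
      -- Insert a cube of radius `τ` between the two. Its centre divides the segment from `y` to `x`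
      -- in the proportion in which `τ` divides `[σ, ρ]`, so both inclusions persist.
      set τ := ρ / q ^ N with hτ
      have hστ : σ < τ := by rw [hτ, lt_div_iff₀ hqN0]; linarith
      have hτq : τ ≤ q * σ := by
        rw [hτ, div_le_iff₀ hqN0]; rw [pow_succ] at hρq; linarith
      have hτρ : τ ≤ ρ := div_le_self (by linarith) hqN
      have hlt' : 0 < ρ - σ := by linarith
      set t := (τ - σ) / (ρ - σ) with ht
      have ht0 : 0 ≤ t := div_nonneg (by linarith) hlt'.le
      have htm : t * (ρ - σ) = τ - σ := div_mul_cancel₀ _ hlt'.ne'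
      have ht1 : t ≤ 1 := by rw [ht, div_le_one hlt']; linarith
      set z := AffineMap.lineMap y x t with hz
      have hd1 : dist y z ≤ τ - σ := by
        rw [hz, dist_left_lineMap, Real.norm_of_nonneg ht0, ← htm]
        gcongr
      have hd2 : dist z x ≤ ρ - τ := by
        rw [hz, dist_lineMap_right, Real.norm_of_nonneg (by linarith)]
        have : ρ - τ = (1 - t) * (ρ - σ) := by rw [sub_mul, htm]; ring
        rw [this]
        exact mul_le_mul_of_nonneg_left hd (by linarith)
      calc _ ≤ 2 ^ N * μ (Metric.closedBall z τ) := ih x z ρ τ (by linarith) hτρ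
            (by rw [hτ, mul_div_cancel₀ _ hqN0.ne']) hd2
        _ ≤ 2 ^ N * (2 * μ (Metric.closedBall y σ)) := by
            gcongr
            exact step z y τ σ hσ hστ.le hτq hd1
        _ = _ := by rw [pow_succ, mul_assoc]
  have hlogq : 0 < Real.log q := Real.log_pos hq
  -- The exponent `d` solves `q ^ d = 2`, turning `2 ^ N` into a power of the radius ratio; the
  -- leading `2` pays for rounding `N` up.
  refine ⟨2, Real.log 2 / Real.log q, by norm_num, div_pos (Real.log_pos (by norm_num)) hlogq,
    fun x y ρ σ hσ hσρ hd => ?_⟩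
  obtain ⟨N, hN1, hN2⟩ := exists_nat_pow_near ((one_le_div hσ).2 hσρ) hq
  have hqd : q ^ (Real.log 2 / Real.log q) = 2 := by
    rw [Real.rpow_def_of_pos (by linarith), mul_div_cancel₀ _ hlogq.ne', Real.exp_log (by norm_num)]
  refine (chain (N + 1) x y ρ σ hσ hσρ ((div_le_iff₀ hσ).1 hN2.le) hd).trans ?_
  gcongr
  rw [← ENNReal.ofReal_ofNat 2, ← ENNReal.ofReal_pow (by norm_num)]
  refine ENNReal.ofReal_le_ofReal ?_
  rw [pow_succ, mul_comm]
  gcongr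
  calc (2 : ℝ) ^ N = (q ^ N) ^ (Real.log 2 / Real.log q) := by
        rw [← Real.rpow_natCast q, ← Real.rpow_mul (by linarith), mul_comm,
          Real.rpow_mul (by linarith), hqd, Real.rpow_natCast]
    _ ≤ _ := Real.rpow_le_rpow (by positivity) hN1 (by have := Real.log_pos one_lt_two; positivity)

theorem one_add_pow_sub_one_le {η : ℝ} (h0 : 0 ≤ η) (h1 : η ≤ 1) (m : ℕ) :
    (1 + η) ^ m - 1 ≤ 2 ^ m * η := by
  have : (1 + η) ^ m - 1 ≤ (2 ^ m - 1) * η := by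
    induction m with
    | zero => simp
    | succ m ih =>
      have h2 : (1 : ℝ) ≤ 2 ^ m := one_le_pow₀ (by norm_num)
      have h3 := mul_le_mul_of_nonneg_right ih (by linarith : 0 ≤ 1 + η)
      have h4 : (2 ^ m - 1) * η * η ≤ (2 ^ m - 1) * η :=
        mul_le_of_le_one_right (mul_nonneg (by linarith) h0) h1
      rw [pow_succ, pow_succ]
      nlinarith
  linarith

/-- Slightly dilating the members of a finite family of cubes slightly increases the measure of
their union. -/
theorem HasPowerModulus.exists_measure_dilate_le [IsFiniteMeasureOnCompacts μ]
    (h : HasPowerModulus μ C c) (hC : 1 ≤ C) (hc : 0 < c) :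
    ∃ K : ℝ, 0 ≤ K ∧ ∀ {ι : Type} (s : Finset ι) (x : ι → Fin n → ℝ) (r : ι → ℝ),
      (∀ i, 0 < r i) → ∀ η : ℝ, 0 < η → η ≤ 1 →
      μ (⋃ i ∈ s, Metric.closedBall (x i) ((1 + η) * r i)) ≤
        ENNReal.ofReal (1 + K * η ^ c) * μ (⋃ i ∈ s, Metric.closedBall (x i) (r i)) := by
  classical
  obtain ⟨D, d, hD, hd, hdoub⟩ := h.exists_doubling hC hc
  refine ⟨C * (2 ^ (2 * n)) ^ c * (D * 15 ^ d), by positivity,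
    fun {ι} s x r hr η hη hη1 => ?_⟩
  set K := C * (2 ^ (2 * n)) ^ c * (D * 15 ^ d) with hKdef
  let B : ι → Set (Fin n → ℝ) := fun i => Metric.closedBall (x i) (r i)
  let B' : ι → Set (Fin n → ℝ) := fun i => Metric.closedBall (x i) ((1 + η) * r i)
  have hBm : ∀ i, MeasurableSet (B i) := fun i => Metric.isClosed_closedBall.measurableSet
  have hBm' : ∀ i, MeasurableSet (B' i) := fun i => Metric.isClosed_closedBall.measurableSet
  obtain ⟨u, hus, hud, hucov⟩ := Vitali.exists_disjoint_subfamily_covering_enlargement_closedBall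
    (s : Set ι) x r (∑ i ∈ s, r i)
    (fun i hi => Finset.single_le_sum (fun j _ => (hr j).le) hi) 5 (by norm_num)
  have hufin : u.Finite := s.finite_toSet.subset hus
  lift u to Finset ι using hufin
  -- The modulus works only inside one cube, so the family is split by Vitali: `I b` holds the cubes
  -- swallowed by the fivefold dilate of `B b`, and `S b` is the halo of that subfamily.
  let I : ι → Finset ι := fun b => s.filter fun i => B i ⊆ Metric.closedBall (x b) (5 * r b)
  let S : ι → Set (Fin n → ℝ) := fun b => (⋃ i ∈ I b, B' i) \ ⋃ i ∈ I b, B i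
  have hball : ∀ b, ∀ i ∈ I b, B' i ⊆ Metric.closedBall (x b) (15 * r b) := by
    intro b i hi y hy
    have hi' := (Finset.mem_filter.1 hi).2
    have h1 : dist (x i) (x b) ≤ 5 * r b := hi' (Metric.mem_closedBall_self (hr i).le)
    set v := (1 + η)⁻¹ • (y - x i) with hv
    have h2 : dist (x i + v) (x b) ≤ 5 * r b := by
      refine hi' ?_
      have hy' : ‖y - x i‖ ≤ (1 + η) * r i := by simpa [B', dist_eq_norm] using hy
      simp only [B, Metric.mem_closedBall, dist_eq_norm, add_sub_cancel_left]
      rw [hv, norm_smul, Real.norm_of_nonneg (by positivity), inv_mul_le_iff₀ (by positivity)]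
      exact hy'
    -- `y` is extrapolated from two points of the fivefold dilate, the centre `x i` and `x i + v`;
    -- this gives radius `5 (1 + 2 η) r b ≤ 15 r b`.
    have h3 : y - x b = (1 + η) • (x i + v - x b) - η • (x i - x b) := by
      rw [smul_sub, smul_add, hv, smul_smul, mul_inv_cancel₀ (by positivity)]
      module
    rw [dist_eq_norm] at h1 h2
    rw [Metric.mem_closedBall, dist_eq_norm, h3]
    calc _ ≤ ‖(1 + η) • (x i + v - x b)‖ + ‖η • (x i - x b)‖ := norm_sub_le _ _
      _ = (1 + η) * ‖x i + v - x b‖ + η * ‖x i - x b‖ := by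
        rw [norm_smul, norm_smul, Real.norm_of_nonneg (by positivity), Real.norm_of_nonneg hη.le]
      _ ≤ (1 + η) * (5 * r b) + η * (5 * r b) := by gcongr
      _ ≤ 15 * r b := by nlinarith [hr b]
  have hBB' : ∀ i, B i ⊆ B' i := fun i =>
    Metric.closedBall_subset_closedBall (by nlinarith [hr i])
  have hS : ∀ b, μ (S b) ≤ ENNReal.ofReal (K * η ^ c) * μ (B b) := by
    intro b
    have hUm : MeasurableSet (⋃ i ∈ I b, B i) := (I b).measurableSet_biUnion fun i _ => hBm i
    have hUm' : MeasurableSet (⋃ i ∈ I b, B' i) := (I b).measurableSet_biUnion fun i _ => hBm' i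
    have hUsub' : (⋃ i ∈ I b, B' i) ⊆ Metric.closedBall (x b) (15 * r b) :=
      Set.iUnion₂_subset (hball b)
    have hUsub : (⋃ i ∈ I b, B i) ⊆ ⋃ i ∈ I b, B' i := Set.iUnion₂_mono fun i _ => hBB' i
    have hvol : volume (S b) ≤ ENNReal.ofReal (2 ^ (2 * n) * η) *
        volume (Metric.closedBall (x b) (15 * r b)) := by
      have hfin : volume (⋃ i ∈ I b, B i) ≠ ∞ :=
        ((measure_mono (hUsub.trans hUsub')).trans_lt measure_closedBall_lt_top).ne
      calc volume (S b) = volume (⋃ i ∈ I b, B' i) - volume (⋃ i ∈ I b, B i) :=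
            measure_sdiff hUsub hUm.nullMeasurableSet hfin
        _ ≤ ENNReal.ofReal (2 ^ (2 * n) * η) * volume (⋃ i ∈ I b, B i) := by
            rw [tsub_le_iff_right]
            refine (volume_iUnion_closedBall_dilate_le (I b) x r (fun i => (hr i).le) hη.le).trans
              ?_
            nth_rw 3 [← one_mul (volume (⋃ i ∈ I b, B i))]
            rw [← add_mul]
            gcongr
            rw [← ENNReal.ofReal_one, ← ENNReal.ofReal_add (by positivity) zero_le_one]
            exact ENNReal.ofReal_le_ofReal (by linarith [one_add_pow_sub_one_le hη.le hη1 (2 * n)])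
        _ ≤ _ := by gcongr; exact hUsub.trans hUsub'
    have h15 : 0 < 15 * r b := by linarith [hr b]
    refine (h (x b) _ h15 (S b) (hUm'.diff hUm) (Set.sdiff_subset.trans hUsub') _ (by positivity)
      hvol).trans ?_
    refine (mul_le_mul_right (hdoub (x b) (x b) (15 * r b) (r b) (hr b) (by linarith [hr b])
      (by rw [dist_self]; linarith [hr b])) _).trans_eq ?_
    rw [mul_div_cancel_right₀ _ (hr b).ne', ← mul_assoc, ← ENNReal.ofReal_mul (by positivity),
      Real.mul_rpow (by positivity) hη.le, hKdef]
    congr 2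
    ring
  -- A point outside all the cubes is outside those of each subfamily, so the global halo is covered
  -- by the local ones; these are then summed over the disjoint `B b`.
  have hcov : (⋃ i ∈ s, B' i) \ (⋃ i ∈ s, B i) ⊆ ⋃ b ∈ u, S b := by
    rintro y ⟨hy, hyn⟩
    obtain ⟨i, hi, hyi⟩ := Set.mem_iUnion₂.1 hy
    obtain ⟨b, hb, hib⟩ := hucov i hi
    refine Set.mem_iUnion₂.2 ⟨b, hb, Set.mem_iUnion₂.2 ⟨i, Finset.mem_filter.2 ⟨hi, hib⟩, hyi⟩,
      fun hyI => hyn ?_⟩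
    obtain ⟨j, hj, hyj⟩ := Set.mem_iUnion₂.1 hyI
    exact Set.mem_iUnion₂.2 ⟨j, (Finset.mem_filter.1 hj).1, hyj⟩
  have hdiff : μ ((⋃ i ∈ s, B' i) \ (⋃ i ∈ s, B i)) ≤
      ENNReal.ofReal (K * η ^ c) * μ (⋃ i ∈ s, B i) := by
    calc _ ≤ μ (⋃ b ∈ u, S b) := measure_mono hcov
      _ ≤ ∑ b ∈ u, μ (S b) := measure_biUnion_finset_le _ _
      _ ≤ ∑ b ∈ u, ENNReal.ofReal (K * η ^ c) * μ (B b) := Finset.sum_le_sum fun b _ => hS b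
      _ = ENNReal.ofReal (K * η ^ c) * μ (⋃ b ∈ u, B b) := by
          rw [← Finset.mul_sum, measure_biUnion_finset hud fun b _ => hBm b]
      _ ≤ _ := by
          refine mul_le_mul_right (measure_mono ?_) _
          exact Set.biUnion_subset_biUnion_left hus
  calc μ (⋃ i ∈ s, B' i) ≤ μ (⋃ i ∈ s, B i) + μ ((⋃ i ∈ s, B' i) \ (⋃ i ∈ s, B i)) :=
        (measure_le_inter_add_sdiff _ _ _).trans
          (add_le_add_left (measure_mono Set.inter_subset_right) _)
    _ ≤ μ (⋃ i ∈ s, B i) + ENNReal.ofReal (K * η ^ c) * μ (⋃ i ∈ s, B i) := by gcongr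
    _ = _ := by
        rw [ENNReal.ofReal_add zero_le_one (by positivity), ENNReal.ofReal_one, add_mul, one_mul]

/-! ### Selection of cubes and the covering estimate -/

/-- A selection of Córdoba–Fefferman type: from finitely many cubes almost filled by `E` one can
select some whose union is almost filled by `E` and whose slight dilates cover all the others. -/
theorem exists_subset_measure_sdiff_le_and_subset_dilate [IsFiniteMeasureOnCompacts μ]
    {D d : ℝ} (hD : 1 ≤ D)
    (hdoub : ∀ (x y : Fin n → ℝ) (ρ σ : ℝ), 0 < σ → σ ≤ ρ → dist y x ≤ ρ - σ →
      μ (Metric.closedBall x ρ) ≤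
        ENNReal.ofReal (D * (ρ / σ) ^ d) * μ (Metric.closedBall y σ))
    {ι : Type*} (s : Finset ι) (x : ι → Fin n → ℝ) (r : ι → ℝ) (hr : ∀ i, 0 < r i)
    (E : Set (Fin n → ℝ)) {κ η : ℝ} (hκ : 0 ≤ κ) (hη : 0 < η) (hη1 : η ≤ 1)
    (hκη : D * (1 / η) ^ d * κ ≤ 1)
    (hE : ∀ i ∈ s, μ (Metric.closedBall (x i) (r i) \ E) ≤
      ENNReal.ofReal (κ ^ 2) * μ (Metric.closedBall (x i) (r i))) :
    ∃ S ⊆ s, μ ((⋃ i ∈ S, Metric.closedBall (x i) (r i)) \ E) ≤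
        ENNReal.ofReal κ * μ (⋃ i ∈ S, Metric.closedBall (x i) (r i)) ∧
      ∀ i ∈ s, Metric.closedBall (x i) (r i) ⊆
        ⋃ j ∈ S, Metric.closedBall (x j) ((1 + 2 * η) * r j) := by
  classical
  induction s using Finset.induction_on_min_value r with
  | empty => exact ⟨∅, subset_rfl, by simp, by simp⟩
  | insert a s _ hmin ih =>
    obtain ⟨S, hSs, hSE, hScov⟩ := ih fun i hi => hE i (Finset.mem_insert_of_mem hi)
    set G := ⋃ i ∈ S, Metric.closedBall (x i) (r i) with hG
    have hGm : MeasurableSet G :=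
      S.measurableSet_biUnion fun i _ => Metric.isClosed_closedBall.measurableSet
    set Q := Metric.closedBall (x a) (r a) with hQ
    have hQm : MeasurableSet Q := Metric.isClosed_closedBall.measurableSet
    have hra := hr a
    -- Cubes arrive in order of decreasing size. Keeping `Q` when its new part has mass at least `κ
    -- μ(Q)` lets the error `κ² μ(Q)` be charged to `κ μ(Q \ G)`.
    rcases le_or_gt (ENNReal.ofReal κ * μ Q) (μ (Q \ G)) with hbig | hsmall
    · refine ⟨insert a S, Finset.insert_subset_insert a hSs, ?_, ?_⟩
      · rw [Finset.set_biUnion_insert, ← hG, Set.union_comm, ← Set.union_sdiff_self]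
        calc μ ((G ∪ Q \ G) \ E) ≤ μ (G \ E) + μ (Q \ E) := by
              rw [Set.union_sdiff_distrib]
              refine (measure_union_le _ _).trans (add_le_add_right (measure_mono ?_) _)
              exact Set.sdiff_subset_sdiff_left Set.sdiff_subset
          _ ≤ ENNReal.ofReal κ * μ G + ENNReal.ofReal (κ ^ 2) * μ Q :=
              add_le_add hSE (hE a (Finset.mem_insert_self a s))
          _ ≤ ENNReal.ofReal κ * μ G + ENNReal.ofReal κ * μ (Q \ G) := by
              rw [pow_two, ENNReal.ofReal_mul hκ, mul_assoc]
              gcongr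
          _ = _ := by
              rw [← mul_add, measure_union Set.disjoint_sdiff_right (hQm.diff hGm)]
      · rw [Finset.set_biUnion_insert]
        intro i hi
        rcases Finset.mem_insert.1 hi with rfl | hi
        · exact (Metric.closedBall_subset_closedBall (by nlinarith)).trans Set.subset_union_left
        · exact (hScov i hi).trans Set.subset_union_right
    · refine ⟨S, hSs.trans (Finset.subset_insert a s), hSE, fun i hi => ?_⟩
      rcases Finset.mem_insert.1 hi with rfl | hi
      swap
      · exact hScov i hi
      intro y hy
      by_contra hyn
      -- Moving an uncovered `y` slightly towards the centre gives a cube of radius `η * r i` inside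
      -- `Q`. It misses `G`: selected cubes are no smaller, so meeting one would put `y` in its `(1
      -- + 2 η)`-dilate. By doubling its mass is at least `κ μ(Q)`, against rejection.
      set z := AffineMap.lineMap y (x i) η with hz
      have hyd : dist y (x i) ≤ r i := hy
      have hzx : dist z (x i) ≤ r i - η * r i := by
        rw [hz, dist_lineMap_right, Real.norm_of_nonneg (by linarith)]
        nlinarith
      have hzy : dist z y ≤ η * r i := by
        rw [hz, dist_lineMap_left, Real.norm_of_nonneg hη.le]
        gcongr
      have hηr : 0 < η * r i := by positivity
      have hP : Metric.closedBall z (η * r i) ⊆ Q \ G := by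
        intro p hp
        refine ⟨Metric.closedBall_subset_closedBall' (by linarith) hp, fun hpG => hyn ?_⟩
        obtain ⟨j, hj, hpj⟩ := Set.mem_iUnion₂.1 hpG
        refine Set.mem_iUnion₂.2 ⟨j, hj, ?_⟩
        have hpj' : dist p (x j) ≤ r j := hpj
        have hpz : dist p z ≤ η * r i := hp
        have hrij : η * r i ≤ η * r j := by gcongr; exact hmin j (hSs hj)
        have h1 := dist_triangle y p (x j)
        have h2 := dist_triangle_right y p z
        rw [dist_comm y z] at h2
        rw [Metric.mem_closedBall]
        linarith
      have h1 : μ (Metric.closedBall z (η * r i)) < ENNReal.ofReal κ * μ Q :=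
        (measure_mono hP).trans_lt hsmall
      have h2 := hdoub (x i) z (r i) (η * r i) hηr (by nlinarith) hzx
      have h3 : r i / (η * r i) = 1 / η := by field_simp
      rw [h3] at h2
      have hpos : 0 < D * (1 / η) ^ d := by positivity
      have h4 : ENNReal.ofReal (D * (1 / η) ^ d) * μ (Metric.closedBall z (η * r i)) <
          ENNReal.ofReal (D * (1 / η) ^ d) * (ENNReal.ofReal κ * μ Q) :=
        (ENNReal.mul_lt_mul_iff_right (by simpa using hpos) ENNReal.ofReal_ne_top).2 h1
      rw [← mul_assoc, ← ENNReal.ofReal_mul hpos.le] at h4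
      refine absurd (h2.trans_lt h4) (not_lt.2 ?_)
      calc _ ≤ 1 * μ Q := by gcongr; exact ENNReal.ofReal_le_one.2 hκη
        _ = μ Q := one_mul _

end PowerModulus

/-- The union of finitely many cubes, each filled by `E` up to a proportion `ε`, has measure at most
`1 + A * ε ^ a` times that of `E`. -/
theorem HasPowerModulus.exists_measure_iUnion_le {n : ℕ} {μ : Measure (Fin n → ℝ)} {C c : ℝ}
    [IsFiniteMeasureOnCompacts μ] (h : HasPowerModulus μ C c) (hC : 1 ≤ C) (hc : 0 < c) :
    ∃ A a ε₀ : ℝ, 0 < A ∧ 0 < a ∧ 0 < ε₀ ∧ ∀ ε : ℝ, 0 < ε → ε ≤ ε₀ →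
      ∀ {ι : Type} (s : Finset ι) (x : ι → Fin n → ℝ) (r : ι → ℝ), (∀ i, 0 < r i) →
      ∀ E : Set (Fin n → ℝ), (∀ i ∈ s, μ (Metric.closedBall (x i) (r i) \ E) ≤
        ENNReal.ofReal ε * μ (Metric.closedBall (x i) (r i))) →
      μ (⋃ i ∈ s, Metric.closedBall (x i) (r i)) ≤ ENNReal.ofReal (1 + A * ε ^ a) * μ E := by
  obtain ⟨D, d, hD, hd, hdoub⟩ := h.exists_doubling hC hc
  obtain ⟨K, hK, hdil⟩ := h.exists_measure_dilate_le hC hc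
  have hD0 : 0 < D := by linarith
  -- The losses are `(2 η) ^ c`, of order `ε ^ (c / (2 d))`, and `κ = ε ^ (1 / 2)`; the smaller
  -- exponent wins. The threshold for `ε` below ensures `κ ≤ 1 / 2` and `2 * η ≤ 1`.
  set a := min (c / (2 * d)) (1 / 2) with ha
  refine ⟨2 * K * (2 ^ c * D ^ (c / d)) + 2, a, min (((1 / 2) ^ d / D) ^ 2) (1 / 4),
    by positivity, lt_min (by positivity) (by norm_num), lt_min (by positivity) (by norm_num),
    fun ε hε hε0 {ι} s x r hr E hE => ?_⟩
  set κ := Real.sqrt ε with hκ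
  have hκ0 : 0 < κ := Real.sqrt_pos.2 hε
  have hκ1 : κ ≤ 1 / 2 := Real.sqrt_le_iff.2 ⟨by norm_num, by linarith [hε0.trans (min_le_right _ _)]⟩
  have hκD : D * κ ≤ (1 / 2) ^ d := by
    rw [mul_comm, ← le_div_iff₀ hD0]
    exact Real.sqrt_le_iff.2 ⟨by positivity, hε0.trans (min_le_left _ _)⟩
  have hε1 : ε ≤ 1 := by linarith [hε0.trans (min_le_right _ _)]
  -- The smallest `η` allowed by the selection: `D * (1 / η) ^ d * κ = 1`.
  set η := (D * κ) ^ (1 / d) with hη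
  have hη0 : 0 < η := by positivity
  have hηd : η ^ d = D * κ := by
    rw [hη, ← Real.rpow_mul (by positivity), one_div_mul_cancel hd.ne', Real.rpow_one]
  have hη1 : η ≤ 1 / 2 := by
    refine (Real.rpow_le_rpow_iff hη0.le (by norm_num) hd).1 ?_
    rwa [hηd]
  obtain ⟨S, -, hSE, hScov⟩ := exists_subset_measure_sdiff_le_and_subset_dilate hD hdoub s x r hr E
    hκ0.le hη0 (by linarith) (by
      rw [Real.div_rpow zero_le_one hη0.le, Real.one_rpow, hηd]
      exact le_of_eq (by field_simp))
    (by rwa [hκ, Real.sq_sqrt hε.le])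
  set G := ⋃ i ∈ S, Metric.closedBall (x i) (r i) with hG
  have hGfin : μ G ≠ ∞ :=
    (S.isCompact_biUnion fun i _ => isCompact_closedBall (x i) (r i)).measure_lt_top.ne
  have hGE : μ G ≤ ENNReal.ofReal (1 + 2 * κ) * μ E := by
    by_cases hEtop : μ E = ∞
    · rw [hEtop, ENNReal.mul_top (by simp; positivity)]; exact le_top
    have h1 : μ G ≤ μ E + ENNReal.ofReal κ * μ G :=
      (measure_le_inter_add_sdiff _ G E).trans
        (add_le_add (measure_mono Set.inter_subset_right) hSE)
    have hκG : ENNReal.ofReal κ * μ G ≠ ∞ := ENNReal.mul_ne_top (by simp) hGfin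
    rw [← ENNReal.toReal_le_toReal hGfin (ENNReal.add_ne_top.2 ⟨hEtop, hκG⟩),
      ENNReal.toReal_add hEtop hκG, ENNReal.toReal_mul, ENNReal.toReal_ofReal hκ0.le] at h1
    rw [← ENNReal.toReal_le_toReal hGfin (ENNReal.mul_ne_top (by simp) hEtop), ENNReal.toReal_mul,
      ENNReal.toReal_ofReal (by positivity)]
    have hG0 : 0 ≤ (μ G).toReal := ENNReal.toReal_nonneg
    -- `1 / (1 - κ) ≤ 1 + 2 κ` because `κ ≤ 1 / 2`.
    calc (μ G).toReal ≤ (1 + 2 * κ) * (1 - κ) * (μ G).toReal := by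
          refine le_mul_of_one_le_left hG0 ?_
          nlinarith
      _ ≤ _ := by
          rw [mul_assoc]
          gcongr
          linarith
  calc μ (⋃ i ∈ s, Metric.closedBall (x i) (r i))
      ≤ μ (⋃ j ∈ S, Metric.closedBall (x j) ((1 + 2 * η) * r j)) :=
        measure_mono (Set.iUnion₂_subset hScov)
    _ ≤ ENNReal.ofReal (1 + K * (2 * η) ^ c) * μ G :=
        hdil S x r hr (2 * η) (by positivity) (by linarith)
    _ ≤ ENNReal.ofReal (1 + K * (2 * η) ^ c) * (ENNReal.ofReal (1 + 2 * κ) * μ E) := by gcongr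
    _ = ENNReal.ofReal ((1 + K * (2 * η) ^ c) * (1 + 2 * κ)) * μ E := by
        rw [← mul_assoc, ← ENNReal.ofReal_mul (by positivity)]
    _ ≤ _ := by
        gcongr
        have hηc : (2 * η) ^ c = 2 ^ c * D ^ (c / d) * ε ^ (c / (2 * d)) := by
          rw [Real.mul_rpow (by norm_num) hη0.le, hη, ← Real.rpow_mul (by positivity),
            Real.mul_rpow hD0.le hκ0.le, hκ, Real.sqrt_eq_rpow, ← Real.rpow_mul hε.le, mul_assoc]
          congr 3 <;> ring
        have h1 : (2 * η) ^ c ≤ 2 ^ c * D ^ (c / d) * ε ^ a := by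
          rw [hηc]
          exact mul_le_mul_of_nonneg_left
            (Real.rpow_le_rpow_of_exponent_ge hε hε1 (min_le_left _ _)) (by positivity)
        have h2 : κ ≤ ε ^ a := by
          rw [hκ, Real.sqrt_eq_rpow]
          exact Real.rpow_le_rpow_of_exponent_ge hε hε1 (min_le_right _ _)
        have h3 : 0 ≤ K * (2 * η) ^ c := by positivity
        have h4 := mul_le_mul_of_nonneg_left h1 hK
        nlinarith

/-! ### From finite families to the maximal operator, and the limit -/

/-- A bound for the measure of all finite unions of closed cubes from a family passes to the union
of all the open ones. -/
theorem measure_iUnion_ball_le_of_finset {n : ℕ} {μ : Measure (Fin n → ℝ)} {ι : Type*}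
    {x : ι → Fin n → ℝ} {r : ι → ℝ} {M : ℝ≥0∞}
    (h : ∀ (g : ℕ → ι) (s : Finset ℕ), μ (⋃ k ∈ s, Metric.closedBall (x (g k)) (r (g k))) ≤ M) :
    μ (⋃ i, Metric.ball (x i) (r i)) ≤ M := by
  obtain ⟨T, hT, hTU⟩ := TopologicalSpace.isOpen_iUnion_countable
    (fun i => Metric.ball (x i) (r i)) fun i => Metric.isOpen_ball
  rw [← hTU]
  rcases T.eq_empty_or_nonempty with rfl | hne
  · simp
  obtain ⟨g, rfl⟩ := hT.exists_eq_range hne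
  rw [Set.biUnion_range, measure_iUnion_eq_iSup_accumulate]
  refine iSup_le fun N => (measure_mono ?_).trans (h g (Finset.Iic N))
  rw [Set.accumulate_def]
  exact Set.iUnion₂_mono' fun k hk => ⟨k, Finset.mem_Iic.2 hk, Metric.ball_subset_closedBall⟩

theorem exists_lt_measure_of_lt_maximalFunction {n : ℕ} {μ : Measure (Fin n → ℝ)}
    {E : Set (Fin n → ℝ)} (hE : NullMeasurableSet E μ) {α : ℝ} {x : Fin n → ℝ}
    (hx : ENNReal.ofReal α < maximalFunction μ (E.indicator fun _ => (1 : ℝ)) x) :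
    ∃ (c : Fin n → ℝ) (ρ : ℝ), 0 < ρ ∧ x ∈ Metric.closedBall c ρ ∧
      ENNReal.ofReal α * μ (Metric.closedBall c ρ) ≤ μ (Metric.closedBall c ρ ∩ E) := by
  simp only [maximalFunction, lt_iSup_iff] at hx
  obtain ⟨c, r, hr, hxr, h⟩ := hx
  rw [cube_eq_closedBall c hr.le] at hxr h
  refine ⟨c, r / 2, half_pos hr, hxr, (ENNReal.mul_lt_of_lt_div h).le.trans_eq ?_⟩
  have : ∀ y, ‖E.indicator (fun _ => (1 : ℝ)) y‖ₑ = E.indicator 1 y := fun y => by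
    by_cases hy : y ∈ E <;> simp [hy]
  simp_rw [this]
  rw [lintegral_indicator_one₀ (hE.mono_ac Measure.restrict_le_self.absolutelyContinuous),
    Measure.restrict_apply₀ (hE.mono_ac Measure.restrict_le_self.absolutelyContinuous),
    Set.inter_comm]

/-- A point of the level set may lie on the boundary of its closed cube. Dilating by a `q > 1` makes
it interior, so open cubes cover and Lindelöf applies; `q` is chosen so that the added shell costs
at most another `ε`, whence `2 * ε`. -/
theorem HasPowerModulus.exists_measure_maximalFunction_le {n : ℕ} {μ : Measure (Fin n → ℝ)}
    {C c : ℝ} [IsFiniteMeasureOnCompacts μ] (h : HasPowerModulus μ C c) (hC : 1 ≤ C) (hc : 0 < c) :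
    ∃ A a ε₀ : ℝ, 0 < A ∧ 0 < a ∧ 0 < ε₀ ∧ ∀ α : ℝ, 0 ≤ α → α < 1 → 1 - α ≤ ε₀ →
      ∀ E : Set (Fin n → ℝ), NullMeasurableSet E μ →
      μ {x | ENNReal.ofReal α < maximalFunction μ (E.indicator fun _ => (1 : ℝ)) x} ≤
        ENNReal.ofReal (1 + A * (1 - α) ^ a) * μ E := by
  obtain ⟨A, a, ε₀, hA, ha, hε₀, hmain⟩ := h.exists_measure_iUnion_le hC hc
  refine ⟨A * 2 ^ a, a, ε₀ / 2, by positivity, ha, by positivity, fun α hα0 hα hαε E hE => ?_⟩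
  set ε := 1 - α with hε
  have hε0 : 0 < ε := by linarith
  obtain ⟨q, hq, hshell⟩ := h.exists_measure_sdiff_le hC hc hε0
  set H := {x | ENNReal.ofReal α < maximalFunction μ (E.indicator fun _ => (1 : ℝ)) x} with hH
  choose! z ρ hρ hxz hzE using fun x (hx : x ∈ H) => exists_lt_measure_of_lt_maximalFunction hE hx
  have hfin : ∀ z t, μ (Metric.closedBall z t) ≠ ∞ := fun z t =>
    (isCompact_closedBall z t).measure_lt_top.ne
  have hsparse : ∀ x ∈ H, μ (Metric.closedBall (z x) (q * ρ x) \ E) ≤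
      ENNReal.ofReal (2 * ε) * μ (Metric.closedBall (z x) (q * ρ x)) := fun x hx => by
    have hr := hρ x hx
    have hle : ρ x ≤ q * ρ x := by nlinarith
    set Q := Metric.closedBall (z x) (ρ x) with hQ
    set Q' := Metric.closedBall (z x) (q * ρ x) with hQ'
    have hQQ' : Q ⊆ Q' := Metric.closedBall_subset_closedBall hle
    have h1 : μ (Q \ E) ≤ ENNReal.ofReal ε * μ Q := by
      have hadd := measure_inter_add_sdiff₀ Q hE
      have hz := hzE x hx
      have h3 : μ Q = ENNReal.ofReal α * μ Q + ENNReal.ofReal ε * μ Q := by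
        rw [← add_mul, ← ENNReal.ofReal_add hα0 hε0.le, hε, add_sub_cancel, ENNReal.ofReal_one,
          one_mul]
      refine (ENNReal.add_le_add_iff_left (ENNReal.mul_ne_top (by simp) (hfin (z x) (ρ x)) :
        ENNReal.ofReal α * μ Q ≠ ∞)).1 ?_
      rw [← h3, ← hadd]
      gcongr
      rw [hadd]
      exact hz
    calc μ (Q' \ E) ≤ μ (Q' \ Q) + μ (Q \ E) := by
          refine (measure_mono fun y hy => ?_).trans (measure_union_le _ _)
          by_cases hyQ : y ∈ Q
          · exact Or.inr ⟨hyQ, hy.2⟩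
          · exact Or.inl ⟨hy.1, hyQ⟩
      _ ≤ ENNReal.ofReal ε * μ Q' + ENNReal.ofReal ε * μ Q' := by
          refine add_le_add (hshell _ _ _ _ hr hle le_rfl (by rw [dist_self]; linarith))
            (h1.trans ?_)
          gcongr
      _ = _ := by
          rw [← add_mul, ← ENNReal.ofReal_add hε0.le hε0.le, two_mul]
  have hcov : H ⊆ ⋃ x : H, Metric.ball (z x) (q * ρ x) := fun x hx => by
    refine Set.mem_iUnion.2 ⟨⟨x, hx⟩, Metric.closedBall_subset_ball ?_ (hxz x hx)⟩
    have := hρ x hx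
    dsimp only
    nlinarith
  refine (measure_mono hcov).trans (measure_iUnion_ball_le_of_finset fun g s => ?_)
  have := hmain (2 * ε) (by positivity) (by linarith) s (fun k => z (g k)) (fun k => q * ρ (g k))
    (fun k => mul_pos (by linarith) (hρ _ (g k).2)) E fun k _ => hsparse _ (g k).2
  rwa [Real.mul_rpow (by norm_num) hε0.le, ← mul_assoc] at this

/-- A function that is not almost everywhere zero charges some cube. -/
theorem IsWeight.exists_cube_weightMeasure_pos {n : ℕ} {w : (Fin n → ℝ) → ℝ} (hw : IsWeight w)
    (hw0 : ¬ w =ᵐ[volume] 0) :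
    ∃ R : ℝ, 0 < R ∧ 0 < weightMeasure w (cube 0 R) := by
  by_contra! hcon
  refine hw0 ?_
  have h0 : weightMeasure w Set.univ = 0 := by
    have hU : (Set.univ : Set (Fin n → ℝ)) = ⋃ k : ℕ, cube 0 (2 * (k + 1 : ℝ)) := by
      refine (Set.eq_univ_of_forall fun x => ?_).symm
      obtain ⟨k, hk⟩ := exists_nat_ge ‖x‖
      refine Set.mem_iUnion.2 ⟨k, ?_⟩
      rw [cube_eq_closedBall _ (by positivity), mem_closedBall_zero_iff]
      linarith
    rw [hU]
    exact measure_iUnion_null fun k => le_antisymm (hcon _ (by positivity)) zero_le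
  rw [weightMeasure, withDensity_apply _ MeasurableSet.univ, Measure.restrict_univ,
    lintegral_eq_zero_iff' hw.locallyIntegrable.aestronglyMeasurable.aemeasurable.ennreal_ofReal]
    at h0
  filter_upwards [h0] with x hx
  exact le_antisymm (ENNReal.ofReal_eq_zero.1 hx) (hw.nonneg x)

/-- Testing on a cube `E` of positive mass suffices: `M_w χ_E ≥ 1 > α` on `E`. This is the lower
half of the limit. -/
theorem IsWeight.one_le_sharpTauberianConst {n : ℕ} {w : (Fin n → ℝ) → ℝ} (hw : IsWeight w)
    (hw0 : ¬ w =ᵐ[volume] 0) {α : ℝ} (hα : α < 1) : 1 ≤ sharpTauberianConst w α := by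
  obtain ⟨R, hR, hpos⟩ := hw.exists_cube_weightMeasure_pos hw0
  have hQm : MeasurableSet (cube (0 : Fin n → ℝ) R) := measurableSet_cube 0 hR.le
  have hfin : weightMeasure w (cube 0 R) < ∞ := by
    rw [cube_eq_closedBall _ hR.le]
    exact weightMeasure_apply_lt_top_of_isCompact hw (isCompact_closedBall _ _)
  refine le_trans ?_ (le_iSup₂_of_le (cube 0 R) hQm.nullMeasurableSet
    (le_iSup₂_of_le hpos hfin le_rfl))
  rw [ENNReal.le_div_iff_mul_le (Or.inl hpos.ne') (Or.inl hfin.ne), one_mul]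
  refine measure_mono fun x hx => ?_
  refine lt_of_lt_of_le (ENNReal.ofReal_lt_one.2 hα)
    (le_iSup₂_of_le (0 : Fin n → ℝ) R (le_iSup₂_of_le hR hx ?_))
  rw [ENNReal.le_div_iff_mul_le (Or.inl hpos.ne') (Or.inl hfin.ne), one_mul,
    ← setLIntegral_one]
  refine setLIntegral_mono' hQm fun y hy => ?_
  simp [hy]

theorem theorem1p1 {n : ℕ} (hn : 0 < n) (w : (Fin n → ℝ) → ℝ) (hw : IsAInfty w)
    (hw0 : ¬ w =ᵐ[volume] 0) :
    (∃ C : ℝ, 0 < C ∧ ∃ c : ℝ, 0 < c ∧ ∀ᶠ α : ℝ in 𝓝[<] 1,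
      sharpTauberianConst w α ≠ ∞ ∧
        (sharpTauberianConst w α).toReal - 1 ≤ C * (1 - α) ^ c) ∧
    Tendsto (fun α : ℝ => sharpTauberianConst w α) (𝓝[<] 1) (𝓝 1) := by
  obtain ⟨C, c, hC, hc, hmod⟩ := hw.exists_hasPowerModulus
  have : IsFiniteMeasureOnCompacts (weightMeasure w) :=
    ⟨fun K hK => weightMeasure_apply_lt_top_of_isCompact hw.isWeight hK⟩
  obtain ⟨A, a, ε₀, hA, ha, hε₀, hmain⟩ := hmod.exists_measure_maximalFunction_le hC hc
  have hev : ∀ᶠ α : ℝ in 𝓝[<] 1, α < 1 ∧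
      sharpTauberianConst w α ≤ ENNReal.ofReal (1 + A * (1 - α) ^ a) := by
    -- The maximum with `0` keeps `α` non-negative, as the splitting `1 = α + ε` in `ℝ≥0∞` requires.
    have hlt : max 0 (1 - ε₀) < 1 := max_lt one_pos (by linarith)
    filter_upwards [Ioo_mem_nhdsLT hlt] with α hα
    refine ⟨hα.2, iSup₂_le fun E hE => iSup₂_le fun _ _ => ENNReal.div_le_of_le_mul ?_⟩
    exact hmain α ((le_max_left _ _).trans hα.1.le) hα.2
      (by linarith [(le_max_right 0 (1 - ε₀)).trans hα.1.le]) E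
      (hE.mono_ac (withDensity_absolutelyContinuous _ _))
  refine ⟨⟨A, hA, a, ha, hev.mono fun α hα => ?_⟩, ?_⟩
  · have h0 : 0 ≤ (1 - α) ^ a := Real.rpow_nonneg (by linarith [hα.1]) a
    refine ⟨ne_top_of_le_ne_top ENNReal.ofReal_ne_top hα.2, ?_⟩
    have := ENNReal.toReal_le_of_le_ofReal (by positivity) hα.2
    linarith
  · have hlim : Tendsto (fun α : ℝ => ENNReal.ofReal (1 + A * (1 - α) ^ a)) (𝓝[<] 1) (𝓝 1) := by
      have hcont : ContinuousAt (fun α : ℝ => 1 + A * (1 - α) ^ a) 1 :=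
        continuousAt_const.add (continuousAt_const.mul
          ((continuousAt_const.sub continuousAt_id).rpow_const (Or.inr ha.le)))
      have h1 := ENNReal.tendsto_ofReal (hcont.tendsto.mono_left (nhdsWithin_le_nhds (s := Set.Iio 1)))
      simpa [Real.zero_rpow ha.ne'] using h1
    exact tendsto_of_tendsto_of_tendsto_of_le_of_le' tendsto_const_nhds hlim
      (hev.mono fun α hα => hw.isWeight.one_le_sharpTauberianConst hw0 hα.1)
      (hev.mono fun α hα => hα.2)
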